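/- Let $\mathfrak g$ be a finite-dimensional complex simple Lie algebra with Cartan subalgebra $\mathfrak h$, root set $\Delta$, simple roots $\Sigma=\{\alpha_1,\dots,\alpha_r\}$, positive and negative roots $\Delta^{\pm}$ and Weyl group $W$; let $Z_1,\dots,Z_r$ be the basis of $\mathfrak h$ dual to $\Sigma$. Fix a cominuscule simple root $\alpha_{i}$, that is, $\mathfrak g=\mathfrak g_1\oplus\mathfrak g_0\oplus\mathfrak g_{-1}$ with $\mathfrak g_k=\{A\in\mathfrak g : [Z_i,A]=kA\}$, and put $\mathfrak p=\mathfrak g_1\oplus\mathfrak g_0$. For a subspace $\mathfrak s\subset\mathfrak g$ let $\Delta(\mathfrak s)=\{\alpha\in\Delta : \mathfrak g_\alpha\subset\mathfrak s\}$ and $\Delta^+(\mathfrak s)=\Delta(\mathfrak s)\cap\Delta^+$. Let $W_{\mathfrak p}\subset W$ be the subgroup generated by the reflections in the roots of $\mathfrak g_0$, let $W^{\mathfrak p}$ be the set of minimal length representatives of the right cosets $W_{\mathfrak p}\backslash W$, and let $w_0$ be the longest element of $W^{\mathfrak p}$. For $w\in W$ let $\Delta(w)=w\Delta^-\cap\Delta^+$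 be its inversion set and $\mathfrak n_w=\bigoplus_{\alpha\in\Delta(w)}\mathfrak g_{-\alpha}$. Fix $w\in W^{\mathfrak p}\setminus\{1,w_0\}$. Let $\mathfrak q_w\subset\mathfrak g_0$ be the stabilizer of $\mathfrak n_w$, let $J(w)$ be the set of those $j\ne i$ for which $\mathfrak g_{-\alpha_j}\not\subset\mathfrak q_w$, and put $Z_w=\sum_{j\in J(w)}Z_j$, $\mathfrak g_{k,\ell}=\{A\in\mathfrak g_k : [Z_w,A]=\ell A\}$ and $a=\max_{\alpha\in\Delta(w)}\alpha(Z_w)$. Let $$\Pi_{1,a-1}=\{\varepsilon\in\Delta(\mathfrak g_{1,a-1}) : \varepsilon+\alpha\notin\Delta\ \text{ for all }\alpha\in\Delta^+(\mathfrak g_{0,0})\},$$ and for $\varepsilon\in\Pi_{1,a-1}$ let $\Delta(w,\varepsilon)=\{\varepsilon\}\cup\{\nu\in\Delta(\mathfrak g_{1,a}) : \nu-\varepsilon\in\Delta(\mathfrak g_{0,1})\}$. Then $\Delta(w)=\{\alpha\in\Delta(\mathfrak g_1) : \alpha(Z_w)\le a\}$; for every $\varepsilon\in\Pi_{1,a-1}$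 there is $w_\varepsilon\in W^{\mathfrak p}$ with $\Delta(w_\varepsilon)=\Delta(w)\setminus\Delta(w,\varepsilon)$; and the set $\{\Delta(w_\varepsilon) : \varepsilon\in\Pi_{1,a-1}\}$ is precisely the collection of those inversion sets $\Delta(w_1)\subset\Delta(w)$, $w_1\in W^{\mathfrak p}$, that are maximal with respect to inclusion among those with the property $$\Delta(w)\setminus\Delta(w_1)\not\subset\Delta(\mathfrak g_{1,a}).$$ -/

import Mathlib

namespace Cominuscule

open LieAlgebra LieAlgebra.IsKilling Module

noncomputable section

variable {L : Type*} [LieRing L] [LieAlgebra ℂ L] [FiniteDimensional ℂ L] [LieAlgebra.IsSimple ℂ L]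
  {H : LieSubalgebra ℂ L} [H.IsCartanSubalgebra]

/-- `Δ(𝔰)`: the roots whose root space is contained in `𝔰 ⊆ 𝔤`. -/
def rootsIn (s : Submodule ℂ L) : Set H.root :=
  {α | (rootSpace H α.1 : Submodule ℂ L) ≤ s}

/-- The positive roots `Δ⁺`. -/
def posRoots (b : (rootSystem H).Base) : Set H.root := {α | b.IsPos α}

/-- The negative roots `Δ⁻`. -/
def negRoots (b : (rootSystem H).Base) : Set H.root := {α | ¬ b.IsPos α}

/-- `Z_j`: the members of the basis of `𝔥` dual to the basis of `𝔥*` formed by the simple roots. -/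
def gradingElt (b : (rootSystem H).Base) (j : b.support) : H :=
  (evalEquiv ℂ H).symm (b.toWeightBasis.coord j)

/-- The eigenspace `{A ∈ 𝔤 | [Z, A] = k A}`. -/
def adEigenspace (Z : H) (k : ℤ) : Submodule ℂ L :=
  Module.End.eigenspace (LieAlgebra.ad ℂ L (Z : L) : Module.End ℂ L) (k : ℂ)

/-- The `Z_i`-graded piece `𝔤_k`. -/
def grade (b : (rootSystem H).Base) (i : b.support) (k : ℤ) : Submodule ℂ L :=
  adEigenspace (gradingElt b i) k

/-- The simple root `α_i` is cominuscule: `𝔤 = 𝔤₁ ⊕ 𝔤₀ ⊕ 𝔤₋₁`. -/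
def IsCominuscule (b : (rootSystem H).Base) (i : b.support) : Prop :=
  grade b i 1 ⊔ grade b i 0 ⊔ grade b i (-1) = ⊤

/-- The Weyl group `W` of `𝔤`. -/
abbrev Weyl (H : LieSubalgebra ℂ L) [H.IsCartanSubalgebra] : Type _ := (rootSystem H).weylGroup

/-- The Weyl group `W_𝔭` of the reductive part `𝔤₀` of `𝔭 = 𝔤₁ ⊕ 𝔤₀`: the subgroup of `W`
generated by the reflections in the roots of `𝔤₀`. -/
def leviWeyl (b : (rootSystem H).Base) (i : b.support) : Subgroup (Weyl H) :=
  Subgroup.closure (RootPairing.weylGroup.ofIdx (rootSystem H) '' rootsIn (grade b i 0))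

/-- The length of `w`: the least length of a word in the simple reflections with product `w`. -/
def length (b : (rootSystem H).Base) (w : Weyl H) : ℕ :=
  sInf {n | ∃ l : List b.support, l.length = n ∧
    (l.map fun j => RootPairing.weylGroup.ofIdx (rootSystem H) (j : H.root)).prod = w}

/-- The Hasse diagram `W^𝔭`: the elements of minimal length in their right coset `W_𝔭 w`. -/
def hasse (b : (rootSystem H).Base) (i : b.support) : Set (Weyl H) :=
  {w | ∀ u ∈ leviWeyl b i, length b w ≤ length b (u * w)}

/-- `w` is the longest element of `W^𝔭`. -/
def IsLongest (b : (rootSystem H).Base) (i : b.support) (w : Weyl H) : Prop :=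
  w ∈ hasse b i ∧ ∀ v ∈ hasse b i, length b v ≤ length b w

/-- The inversion set `Δ(w) = wΔ⁻ ∩ Δ⁺`. -/
def inversions (b : (rootSystem H).Base) (w : Weyl H) : Set H.root :=
  (fun β => w • β) '' negRoots b ∩ posRoots b

/-- `𝔫_w`: the sum of the root spaces `𝔤_{-α}` for `α ∈ Δ(w)`. -/
def nilp (b : (rootSystem H).Base) (w : Weyl H) : Submodule ℂ L :=
  ⨆ α ∈ inversions b w, (rootSpace H (-(α.1 : H → ℂ)) : Submodule ℂ L)

/-- `𝔮_w`: the stabilizer in `𝔤₀` of the subspace `𝔫_w`, that is, of the line `⋀^{|w|} 𝔫_w` in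
the exterior power of `𝔤₋₁`. -/
def stab (b : (rootSystem H).Base) (i : b.support) (w : Weyl H) : Set L :=
  {x | x ∈ grade b i 0 ∧ ∀ y ∈ nilp b w, ⁅x, y⁆ ∈ nilp b w}

/-- The marking `J(w)`: the simple roots `α_j`, `j ≠ i`, with `𝔤_{-α_j} ⊄ 𝔮_w`. A set `J ∌ i` of
simple roots with `𝔮_w = 𝔤_{0,≥0}`, the grading being that of `∑_{j ∈ J} Z_j`, can only be this
one, because `-α_j` has degree `-1` if `j ∈ J`, and degree `0` otherwise. -/
def marking (b : (rootSystem H).Base) (i : b.support) (w : Weyl H) : Set b.support :=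
  {j | j ≠ i ∧ ¬ ((rootSpace H (-(j.1.1 : H → ℂ)) : Submodule ℂ L) : Set L) ⊆ stab b i w}

open Classical in
/-- `Z_w = ∑_{j ∈ J(w)} Z_j`. -/
def markingElt (b : (rootSystem H).Base) (i : b.support) (w : Weyl H) : H :=
  ∑ j : b.support, if j ∈ marking b i w then gradingElt b j else 0

/-- The bigraded piece `𝔤_{k,ℓ} = {A ∈ 𝔤_k | [Z_w, A] = ℓ A}`. -/
def bigrade (b : (rootSystem H).Base) (i : b.support) (w : Weyl H) (k l : ℤ) : Submodule ℂ L :=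
  grade b i k ⊓ adEigenspace (markingElt b i w) l

/-- The integer `a(w)`: the largest value `α(Z_w)`, `α ∈ Δ(w)`. -/
def level (b : (rootSystem H).Base) (i : b.support) (w : Weyl H) : ℤ :=
  sSup {l : ℤ | ∃ α ∈ inversions b w, (rootSystem H).root α (markingElt b i w) = (l : ℂ)}

/-- `Π_{1,a-1}`: the roots `ε` of `𝔤_{1,a-1}` such that `ε + α` is not a root for any positive
root `α` of `𝔤_{0,0}`. -/
def highest (b : (rootSystem H).Base) (i : b.support) (w : Weyl H) : Set H.root :=
  {ε | ε ∈ rootsIn (bigrade b i w 1 (level b i w - 1)) ∧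
    ∀ α ∈ posRoots b ∩ rootsIn (bigrade b i w 0 0),
      (rootSystem H).root ε + (rootSystem H).root α ∉ Set.range (rootSystem H).root}

/-- `Δ(w, ε) = {ε} ⊔ {ν ∈ Δ(𝔤_{1,a}) | ν - ε ∈ Δ(𝔤_{0,1})}`. -/
def removed (b : (rootSystem H).Base) (i : b.support) (w : Weyl H) (ε : H.root) : Set H.root :=
  {ε} ∪ {ν | ν ∈ rootsIn (bigrade b i w 1 (level b i w)) ∧
    ∃ β ∈ rootsIn (bigrade b i w 0 1),
      (rootSystem H).root ν - (rootSystem H).root ε = (rootSystem H).root β}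

/-- `v` is the element `w_ε`: it lies in `W^𝔭` and `Δ(v) = Δ(w) \ Δ(w, ε)`. -/
def IsWEps (b : (rootSystem H).Base) (i : b.support) (w : Weyl H) (ε : H.root) (v : Weyl H) :
    Prop :=
  v ∈ hasse b i ∧ inversions b v = inversions b w \ removed b i w ε

/-- `Φ ⊆ Δ(w)` is the inversion set of an element of `W^𝔭`, and `Δ(w) \ Φ ⊄ Δ(𝔤_{1,a})`. -/
def IsAdmissible (b : (rootSystem H).Base) (i : b.support) (w : Weyl H) (Φ : Set H.root) : Prop :=
  (∃ v ∈ hasse b i, inversions b v = Φ) ∧ Φ ⊆ inversions b w ∧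
    ¬ inversions b w \ Φ ⊆ rootsIn (bigrade b i w 1 (level b i w))

end

end Cominuscule

/-! Let E(α) be the α_i-coefficient of wα, and d the sum of the coefficients at those simple roots
where E ≠ 0 (`twistDegree`). Cominuscularity confines E to {-1, 0, 1}, and a root α of 𝔤₁ is an
inversion exactly when d(w⁻¹α) < 0. Splitting positive roots along E (`IsGrading`) shows that
d(w⁻¹α_j), for j ≠ i, is 2 if j ∈ J(w) and 0 otherwise (`twistDegree_inv_smul_simple`). Some
inversion has value -1, so d(w⁻¹α) = 2(α(Z_w) - a) - 1 on 𝔤₁; this describes Δ(w).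

Inversion sets of W^𝔭 are the sets of roots of 𝔤₁ closed under subtracting positive roots of 𝔤₀
(`mem_invSet_of_eq_add`, `exists_invSet_eq`). Removing Δ(w, ε) from Δ(w) keeps this closure, which
gives w_ε. Conversely, an inversion set without ε misses all of Δ(w, ε) (`disjoint_removedSet`), and
an admissible one misses some ε ∈ Π_{1,a-1} (`exists_mem_topSet`): take a missing root of greatest
height among those of level at most a - 1. Its level is a - 1, because at lower levels d(w⁻¹α) < -1
and a simple root of 𝔤₀ can still be added. -/

namespace Cominuscule

open LieAlgebra LieAlgebra.IsKilling Module Set LieModule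

noncomputable section

set_option linter.unusedSectionVars false

/-! ### Sums of roots, linear functions on roots, coefficients at simple roots -/

section RootPairing

variable {ι R M N : Type*} [Finite ι] [Field R] [CharZero R] [AddCommGroup M] [Module R M]
  [AddCommGroup N] [Module R N] {P : RootPairing ι R M N} [P.IsCrystallographic] [P.IsReduced]

/-- If `α + β` and `α + β + γ` are roots then so is one of `α + γ` and `β + γ`, unless one of
these vanishes. -/
theorem root_add_mem_or_root_add_mem {i j k s t : ι} (hs : P.root s = P.root i + P.root j)
    (ht : P.root t = P.root s + P.root k) (hik : P.root i + P.root k ≠ 0)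
    (hjk : P.root j + P.root k ≠ 0) :
    (∃ m, P.root m = P.root i + P.root k) ∨ ∃ m, P.root m = P.root j + P.root k := by
  by_contra! h
  obtain ⟨hi, hj⟩ := h
  have key : ∀ a c e : ι, P.root a = P.root c + P.root e → ∀ l,
      P.pairingIn ℤ a l = P.pairingIn ℤ c l + P.pairingIn ℤ e l := by
    intro a c e h l
    apply FaithfulSMul.algebraMap_injective ℤ R
    simp only [map_add, RootPairing.algebraMap_pairingIn, ← RootPairing.root_coroot_eq_pairing, h]
    simp
  -- Roots with negative pairing have a root or zero as sum, so all signs are forced: γ pairs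
  -- nonnegatively with α + β, yet α + β + γ pairs nonpositively with α + β, so that γ pairs
  -- negatively with it.
  have hik' : 0 ≤ P.pairingIn ℤ i k := by
    by_contra! h
    obtain ⟨m, hm⟩ := P.root_add_root_mem_of_pairingIn_neg h
      (fun h ↦ hik (by rw [h]; simp))
    exact hi m hm
  have hjk' : 0 ≤ P.pairingIn ℤ j k := by
    by_contra! h
    obtain ⟨m, hm⟩ := P.root_add_root_mem_of_pairingIn_neg h
      (fun h ↦ hjk (by rw [h]; simp))
    exact hj m hm
  have hti : P.pairingIn ℤ t i ≤ 0 := by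
    by_contra! h
    obtain ⟨m, hm⟩ := P.root_sub_root_mem_of_pairingIn_pos h
      (fun h ↦ hjk (by
        have e : P.root j + P.root k = P.root s + P.root k - P.root i := by rw [hs]; abel
        rw [e, ← ht, h, sub_self]))
    exact hj m (by rw [hm, ht, hs]; abel)
  have htj : P.pairingIn ℤ t j ≤ 0 := by
    by_contra! h
    obtain ⟨m, hm⟩ := P.root_sub_root_mem_of_pairingIn_pos h
      (fun h ↦ hik (by
        have e : P.root i + P.root k = P.root s + P.root k - P.root j := by rw [hs]; abel
        rw [e, ← ht, h, sub_self]))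
    exact hi m (by rw [hm, ht, hs]; abel)
  have h1 := key s i j hs k
  have h2 := key s i j hs t
  have h3 := key t s k ht s
  rw [P.pairingIn_le_zero_iff] at hti htj
  have h4 : P.pairingIn ℤ t s ≤ 0 := by rw [P.pairingIn_le_zero_iff]; omega
  have h5 : P.pairingIn ℤ k s < 0 := by
    have : P.pairingIn ℤ s s = 2 := by simp
    omega
  rw [P.pairingIn_lt_zero_iff] at h5
  omega

variable (P) in
/-- A function on the roots that is the restriction of a linear functional. -/
def IsLinear (f : ι → ℤ) : Prop := ∃ F : M →ₗ[R] R, ∀ i, F (P.root i) = (f i : R)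

namespace IsLinear

variable {f : ι → ℤ}

theorem add_eq (hf : IsLinear P f) {i j k : ι} (h : P.root k = P.root i + P.root j) :
    f k = f i + f j := by
  obtain ⟨F, hF⟩ := hf
  have := congrArg F h
  rw [map_add, hF, hF, hF] at this
  exact_mod_cast this

theorem neg_eq (hf : IsLinear P f) {i j : ι} (h : P.root j = -P.root i) : f j = -f i := by
  obtain ⟨F, hF⟩ := hf
  have := congrArg F h
  rw [map_neg, hF, hF] at this
  exact_mod_cast this

theorem smul (hf : IsLinear P f) (w : P.weylGroup) : IsLinear P fun i ↦ f (w • i) := by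
  obtain ⟨F, hF⟩ := hf
  refine ⟨F ∘ₗ P.weylGroupRootRep w, fun i ↦ ?_⟩
  rw [← hF]
  exact congrArg F (P.weylGroup_apply_root w i)

theorem sum {κ : Type*} (s : Finset κ) {f : κ → ι → ℤ} (hf : ∀ x ∈ s, IsLinear P (f x)) :
    IsLinear P fun i ↦ ∑ x ∈ s, f x i := by
  classical
  choose! F hF using hf
  refine ⟨∑ x ∈ s, F x, fun i ↦ ?_⟩
  rw [LinearMap.sum_apply, Int.cast_sum]
  exact Finset.sum_congr rfl fun x hx ↦ hF x hx i

end IsLinear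

/-- The coefficient of a root at a simple root. -/
def coeff (b : P.Base) (j i : ι) : ℤ := (b.exists_root_eq_sum_int i).choose j

variable (b : P.Base)

theorem root_eq_sum_coeff (i : ι) :
    P.root i = ∑ j ∈ b.support, coeff b j i • P.root j :=
  (b.exists_root_eq_sum_int i).choose_spec.2.2

/-- Linear independence of the simple roots makes the choice inside `coeff` harmless. -/
theorem coord_root [P.IsRootSystem] (j : b.support) (i : ι) :
    b.toWeightBasis.coord j (P.root i) = (coeff b j i : R) := by
  conv_lhs => rw [root_eq_sum_coeff b i]
  rw [← Finset.sum_attach, map_sum, Finset.sum_eq_single j]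
  · simp
  · intro k _ hk
    simp [hk]
  · simp

theorem coeff_isLinear [P.IsRootSystem] {j : ι} (hj : j ∈ b.support) : IsLinear P (coeff b j) :=
  ⟨b.toWeightBasis.coord ⟨j, hj⟩, coord_root b ⟨j, hj⟩⟩

theorem coeff_simple [P.IsRootSystem] {j k : ι} (hj : j ∈ b.support) (hk : k ∈ b.support)
    [Decidable (j = k)] :
    coeff b j k = if j = k then 1 else 0 := by
  have := coord_root b ⟨j, hj⟩ k
  have h2 := b.toWeightBasis_repr_root ⟨k, hk⟩
  simp only [Basis.coord_apply] at this
  rw [h2] at this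
  split_ifs with h
  · subst h
    simpa using this.symm
  · have h3 : (⟨k, hk⟩ : b.support) ≠ ⟨j, hj⟩ := by simpa using Ne.symm h
    simpa [h3] using this.symm

theorem IsLinear.eq_sum {f : ι → ℤ} (hf : IsLinear P f) (i : ι) :
    f i = ∑ j ∈ b.support, coeff b j i * f j := by
  obtain ⟨F, hF⟩ := hf
  have := congrArg F (root_eq_sum_coeff b i)
  simp only [hF, map_sum, map_zsmul, zsmul_eq_mul] at this
  exact_mod_cast this

theorem coeff_nonneg {i : ι} (hi : b.IsPos i) (j : ι) : 0 ≤ coeff b j i := by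
  have h := (b.exists_root_eq_sum_int i).choose_spec.2.1
  rcases h with h | h
  · exact h.le j
  · exfalso
    have : b.height i ≤ 0 := Finset.sum_nonpos fun j _ ↦ h.le j
    exact absurd hi (not_lt.2 this)

theorem coeff_nonpos {i : ι} (hi : ¬ b.IsPos i) (j : ι) : coeff b j i ≤ 0 := by
  have h := (b.exists_root_eq_sum_int i).choose_spec.2.1
  rcases h with h | h
  · exfalso
    have : 0 ≤ b.height i := Finset.sum_nonneg fun j _ ↦ h.le j
    exact hi (b.isPos_iff'.2 this)
  · exact h.le j

theorem height_isLinear [P.IsRootSystem] : IsLinear P b.height :=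
  IsLinear.sum b.support fun _ hj ↦ coeff_isLinear b hj

theorem exists_root_neg (P : RootPairing ι R M N) (i : ι) : ∃ j, P.root j = -P.root i :=
  ⟨P.reflectionPerm i i, by simp⟩

theorem isPos_neg_iff {i j : ι} (h : P.root j = -P.root i) : b.IsPos j ↔ ¬ b.IsPos i := by
  have : j = P.reflectionPerm i i := P.root.injective (by simp [h])
  subst this
  exact RootPairing.Base.IsPos.neg_iff_not b i

theorem root_smul_eq_add {i j k : ι} (h : P.root k = P.root i + P.root j) (w : P.weylGroup) :
    P.root (w • k) = P.root (w • i) + P.root (w • j) := by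
  have e (l : ι) : w • P.root l = P.root (w • l) := P.weylGroup_apply_root w l
  rw [← e, ← e, ← e, h, smul_add]

theorem root_smul_eq_neg {i j : ι} (h : P.root j = -P.root i) (w : P.weylGroup) :
    P.root (w • j) = -P.root (w • i) := by
  have e (l : ι) : w • P.root l = P.root (w • l) := P.weylGroup_apply_root w l
  rw [← e, ← e, h, smul_neg]

end RootPairing

/-! ### Splitting positive roots along a three-valued grading -/

section Grading

variable {ι R M N : Type*} [Finite ι] [Field R] [CharZero R] [AddCommGroup M] [Module R M]
  [AddCommGroup N] [Module R N] {P : RootPairing ι R M N} [P.IsCrystallographic] [P.IsReduced]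
  {b : P.Base}

theorem root_add_root_ne_zero {i j : ι} (hi : b.IsPos i) (hj : b.IsPos j) :
    P.root i + P.root j ≠ 0 := fun h ↦
  (isPos_neg_iff b (eq_neg_of_add_eq_zero_right h)).1 hj hi

@[elab_as_elim]
theorem isPos_induction {p : ι → Prop} {i : ι} (hi : b.IsPos i) (simple : ∀ k ∈ b.support, p k)
    (add : ∀ i l k, b.IsPos i → l ∈ b.support → P.root k = P.root i + P.root l → p i → p k) :
    p i := by
  suffices h : b.IsPos i ∧ p i from h.2
  refine hi.induction_on_add (p := fun i ↦ b.IsPos i ∧ p i)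
    (fun i hi ↦ ⟨RootPairing.Base.isPos_of_mem_support hi, simple i hi⟩) ?_
  intro i j k h hi hj
  exact ⟨hi.1.add (RootPairing.Base.isPos_of_mem_support hj) h, add i j k hi.1 hj h hi.2⟩

theorem exists_eq_add_simple {i : ι} (hi : b.IsPos i) (hi' : i ∉ b.support) :
    ∃ j k, b.IsPos j ∧ k ∈ b.support ∧ P.root i = P.root j + P.root k := by
  revert hi'
  refine isPos_induction hi (fun k hk hk' ↦ absurd hk hk') ?_
  intro i j k hi hj h _ _
  exact ⟨i, j, hi, hj, h⟩

variable (b) in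
/-- Linear functions `E` and `d` on the roots, `E` with values in `{-1, 0, 1}` and `d` the sum of
the coefficients at the simple roots on which `E` does not vanish. -/
structure IsGrading (E d : ι → ℤ) : Prop where
  linear : IsLinear P E
  linear_degree : IsLinear P d
  neg_one_le : ∀ i, -1 ≤ E i
  le_one : ∀ i, E i ≤ 1
  degree_of_eq_zero : ∀ k ∈ b.support, E k = 0 → d k = 0
  degree_of_ne_zero : ∀ k ∈ b.support, E k ≠ 0 → d k = 1

namespace IsGrading

variable {E d : ι → ℤ}

theorem neg (h : IsGrading b E d) : IsGrading b (-E) d where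
  linear := by
    obtain ⟨F, hF⟩ := h.linear
    exact ⟨-F, fun i ↦ by simp [hF]⟩
  linear_degree := h.linear_degree
  neg_one_le i := by have := h.le_one i; simp only [Pi.neg_apply]; omega
  le_one i := by have := h.neg_one_le i; simp only [Pi.neg_apply]; omega
  degree_of_eq_zero k hk h0 := h.degree_of_eq_zero k hk (by simpa using h0)
  degree_of_ne_zero k hk h0 := h.degree_of_ne_zero k hk (by simpa using h0)

theorem degree_simple_nonneg (h : IsGrading b E d) {k : ι} (hk : k ∈ b.support) : 0 ≤ d k := by
  by_cases hE : E k = 0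
  · rw [h.degree_of_eq_zero k hk hE]
  · rw [h.degree_of_ne_zero k hk hE]; omega

theorem degree_nonneg (h : IsGrading b E d) {i : ι} (hi : b.IsPos i) : 0 ≤ d i := by
  refine hi.induction_on_add (fun k hk ↦ h.degree_simple_nonneg hk) fun i j k hk hi hj ↦ ?_
  rw [h.linear_degree.add_eq hk]
  have := h.degree_simple_nonneg hj
  omega

/-- A nonzero E needs a simple summand with nonzero E, which contributes 1 to d. -/
theorem degree_pos (h : IsGrading b E d) {i : ι} (hi : b.IsPos i) (hE : E i ≠ 0) : 0 < d i := by
  revert hE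
  refine isPos_induction hi (fun k hk hE ↦ ?_) fun i j k hi hj hk ih hE ↦ ?_
  · rw [h.degree_of_ne_zero k hk hE]; omega
  · rw [h.linear_degree.add_eq hk]
    have h1 := h.linear.add_eq hk
    have h2 := h.degree_simple_nonneg hj
    have h3 := h.degree_nonneg hi
    by_cases h4 : E i = 0
    · rw [h.degree_of_ne_zero j hj (by omega)]
      omega
    · have := ih h4
      omega

/-- A positive root of degree zero for `E` and of positive degree for `d` is a sum of two positive
roots on which `E` takes the values `-1` and `1`. -/
theorem exists_add_of_eq_zero (h : IsGrading b E d) {i : ι} (hi : b.IsPos i) (hE : E i = 0)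
    (hd : 0 < d i) : ∃ j k, b.IsPos j ∧ b.IsPos k ∧ P.root i = P.root j + P.root k ∧
      E j = -1 ∧ E k = 1 := by
  revert hE hd
  refine isPos_induction hi (fun k hk ↦ ?_) fun i l k hi hl hk ih ↦ ?_
  · intro hE hd
    have := h.degree_of_eq_zero k hk hE
    omega
  · intro hE hd
    have hlp : b.IsPos l := RootPairing.Base.isPos_of_mem_support hl
    have h1 := h.linear.add_eq hk
    have h2 := h.linear_degree.add_eq hk
    have h3 := h.neg_one_le l
    have h4 := h.le_one l
    by_cases hl0 : E l = 0
    · have h5 := h.degree_of_eq_zero l hl hl0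
      obtain ⟨j, m, hj, hm, hjm, hEj, hEm⟩ := ih (by omega) (by omega)
      -- The simple root `l` has E = 0, so whichever half absorbs it keeps its value of E.
      rcases root_add_mem_or_root_add_mem hjm hk (root_add_root_ne_zero hj hlp)
        (root_add_root_ne_zero hm hlp) with ⟨n, hn⟩ | ⟨n, hn⟩
      · refine ⟨n, m, hj.add hlp hn, hm, by rw [hk, hjm, hn]; abel, ?_, hEm⟩
        rw [h.linear.add_eq hn]; omega
      · refine ⟨j, n, hj, hm.add hlp hn, by rw [hk, hjm, hn]; abel, hEj, ?_⟩
        rw [h.linear.add_eq hn]; omega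
    · by_cases hl1 : E l = 1
      · exact ⟨i, l, hi, hlp, hk, by omega, hl1⟩
      · exact ⟨l, i, hlp, hi, by rw [hk]; abel, by omega, by omega⟩

/-- A positive root on which `E` is `1` and `d` is not is the sum of a positive root with `E = 0`
and `0 < d` and a positive root with `E = 1`. -/
theorem exists_add_of_eq_one (h : IsGrading b E d) {i : ι} (hi : b.IsPos i) (hE : E i = 1)
    (hd : 1 < d i) : ∃ j k, b.IsPos j ∧ b.IsPos k ∧ P.root i = P.root j + P.root k ∧
      E j = 0 ∧ 0 < d j ∧ E k = 1 := by
  revert hE hd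
  refine isPos_induction hi (fun k hk ↦ ?_) fun i l k hi hl hk ih ↦ ?_
  · intro hE hd
    have := h.degree_of_ne_zero k hk (by omega)
    omega
  · intro hE hd
    have hlp : b.IsPos l := RootPairing.Base.isPos_of_mem_support hl
    have h1 := h.linear.add_eq hk
    have h2 := h.linear_degree.add_eq hk
    have h3 := h.neg_one_le l
    have h4 := h.le_one l
    have h5 := h.le_one i
    by_cases hl0 : E l = 0
    · have h5 := h.degree_of_eq_zero l hl hl0
      obtain ⟨j, m, hj, hm, hjm, hEj, hdj, hEm⟩ := ih (by omega) (by omega)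
      rcases root_add_mem_or_root_add_mem hjm hk (root_add_root_ne_zero hj hlp)
        (root_add_root_ne_zero hm hlp) with ⟨n, hn⟩ | ⟨n, hn⟩
      · refine ⟨n, m, hj.add hlp hn, hm, by rw [hk, hjm, hn]; abel, ?_, ?_, hEm⟩
        · rw [h.linear.add_eq hn]; omega
        · rw [h.linear_degree.add_eq hn]; omega
      · refine ⟨j, n, hj, hm.add hlp hn, by rw [hk, hjm, hn]; abel, hEj, hdj, ?_⟩
        rw [h.linear.add_eq hn]; omega
    · have h6 := h.degree_of_ne_zero l hl hl0
      exact ⟨i, l, hi, hlp, hk, by omega, by omega, by omega⟩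

theorem exists_add_of_two_lt_aux (h : IsGrading b E d) {i l k : ι} (hi : b.IsPos i)
    (hl : l ∈ b.support) (hk : P.root k = P.root i + P.root l) (hE : E k = 0) (hd : 2 < d k)
    (hEl : E l = -1) : ∃ j m, b.IsPos j ∧ b.IsPos m ∧ P.root k = P.root j + P.root m ∧
      E j = 0 ∧ E m = 0 := by
  have hlp : b.IsPos l := RootPairing.Base.isPos_of_mem_support hl
  have h1 := h.linear.add_eq hk
  have h2 := h.linear_degree.add_eq hk
  have h3 := h.degree_of_ne_zero l hl (by omega)
  obtain ⟨j, m, hj, hm, hjm, hEj, hdj, hEm⟩ := h.exists_add_of_eq_one hi (by omega) (by omega)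
  rcases root_add_mem_or_root_add_mem hjm hk (root_add_root_ne_zero hj hlp)
    (root_add_root_ne_zero hm hlp) with ⟨n, hn⟩ | ⟨n, hn⟩
  -- Here `j + l` is a root. After splitting `j`, the bounds on E rule out `y + m` and `x + l`, so
  -- the pieces regroup as (x + m) + (y + l).
  · obtain ⟨x, y, hx, hy, hxy, hEx, hEy⟩ := h.exists_add_of_eq_zero hj hEj hdj
    obtain ⟨u, hu⟩ : ∃ u, P.root u = P.root x + P.root m := by
      rcases root_add_mem_or_root_add_mem hxy hjm (root_add_root_ne_zero hx hm)
        (root_add_root_ne_zero hy hm) with ⟨u, hu⟩ | ⟨u, hu⟩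
      · exact ⟨u, hu⟩
      · have := h.linear.add_eq hu
        have := h.le_one u
        omega
    obtain ⟨v, hv⟩ : ∃ v, P.root v = P.root y + P.root l := by
      rcases root_add_mem_or_root_add_mem hxy hn (root_add_root_ne_zero hx hlp)
        (root_add_root_ne_zero hy hlp) with ⟨v, hv⟩ | ⟨v, hv⟩
      · have := h.linear.add_eq hv
        have := h.neg_one_le v
        omega
      · exact ⟨v, hv⟩
    refine ⟨u, v, hx.add hm hu, hy.add hlp hv, by rw [hk, hjm, hxy, hu, hv]; abel, ?_, ?_⟩
    · rw [h.linear.add_eq hu]; omega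
    · rw [h.linear.add_eq hv]; omega
  · refine ⟨j, n, hj, hm.add hlp hn, by rw [hk, hjm, hn]; abel, hEj, ?_⟩
    rw [h.linear.add_eq hn]; omega

/-- A positive root with `E = 0` and `2 < d` is a sum of two positive roots with `E = 0`. -/
theorem exists_add_of_two_lt (h : IsGrading b E d) {k : ι} (hkp : b.IsPos k) (hE : E k = 0)
    (hd : 2 < d k) : ∃ j m, b.IsPos j ∧ b.IsPos m ∧ P.root k = P.root j + P.root m ∧
      E j = 0 ∧ E m = 0 := by
  have hks : k ∉ b.support := fun hk ↦ by
    have := h.degree_of_eq_zero k hk hE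
    omega
  obtain ⟨i, l, hi, hl, hk⟩ := exists_eq_add_simple hkp hks
  have h1 := h.linear.add_eq hk
  have h2 := h.neg_one_le l
  have h3 := h.le_one l
  rcases (by omega : E l = 0 ∨ E l = -1 ∨ E l = 1) with hEl | hEl | hEl
  · exact ⟨i, l, hi, RootPairing.Base.isPos_of_mem_support hl, hk, by omega, hEl⟩
  · exact h.exists_add_of_two_lt_aux hi hl hk hE hd hEl
  · obtain ⟨j, m, hj, hm, hjm, hEj, hEm⟩ :=
      h.neg.exists_add_of_two_lt_aux hi hl hk (by simpa using hE) hd (by simpa using hEl)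
    exact ⟨j, m, hj, hm, hjm, by simpa using hEj, by simpa using hEm⟩

end IsGrading

end Grading

/-! ### Length equals the number of inversions -/

section Length

variable {ι R M N : Type*} [Finite ι] [Field R] [CharZero R] [AddCommGroup M] [Module R M]
  [AddCommGroup N] [Module R N] {P : RootPairing ι R M N} [P.IsCrystallographic] [P.IsReduced]

open RootPairing.weylGroup (ofIdx)

theorem weylGroup_ext {v w : P.weylGroup} (h : ∀ x : M, v • x = w • x) : v = w := by
  apply Subtype.ext
  apply RootPairing.Equiv.weightHom_injective P
  ext x
  exact h x

theorem ofIdx_mul_self (j : ι) : ofIdx P j * ofIdx P j = 1 := by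
  refine weylGroup_ext fun x ↦ ?_
  rw [mul_smul, one_smul]
  exact P.reflection_same j x

theorem ofIdx_inv (j : ι) : (ofIdx P j)⁻¹ = ofIdx P j :=
  inv_eq_of_mul_eq_one_left (ofIdx_mul_self j)

theorem ofIdx_reflectionPerm (j i : ι) :
    ofIdx P (P.reflectionPerm j i) = ofIdx P j * ofIdx P i * ofIdx P j := by
  refine weylGroup_ext fun x ↦ ?_
  rw [mul_smul, mul_smul]
  exact LinearEquiv.congr_fun (P.reflection_reflectionPerm (i := i) (j := j)) x

theorem root_ofIdx_smul_self (j : ι) : P.root (ofIdx P j • j) = -P.root j := by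
  change P.root (P.reflectionPerm j j) = _
  simp

variable (b : P.Base)

/-- The product of the simple reflections of a word. -/
def wordProd (l : List b.support) : P.weylGroup :=
  (l.map fun j ↦ ofIdx P (j : ι)).prod

variable {b}

theorem wordProd_cons (j : b.support) (l : List b.support) :
    wordProd b (j :: l) = ofIdx P (j : ι) * wordProd b l := by
  simp [wordProd]

theorem wordProd_append (l l' : List b.support) :
    wordProd b (l ++ l') = wordProd b l * wordProd b l' := by
  simp [wordProd]

theorem wordProd_singleton (j : b.support) : wordProd b [j] = ofIdx P (j : ι) := by
  simp [wordProd]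

theorem ofIdx_wordProd_smul (l : List b.support) (j : ι) :
    ofIdx P (wordProd b l • j) = wordProd b l * ofIdx P j * (wordProd b l)⁻¹ := by
  induction l with
  | nil => simp [wordProd]
  | cons k l ih =>
    rw [wordProd_cons, mul_smul, mul_inv_rev, ofIdx_inv]
    change ofIdx P (P.reflectionPerm k _) = _
    rw [ofIdx_reflectionPerm, ih]
    group

variable (b) in
theorem exists_wordProd_eq (w : P.weylGroup) : ∃ l, wordProd b l = w := by
  have hmul : ∀ u v : P.weylGroup, (∃ l, wordProd b l = u) → (∃ l, wordProd b l = v) →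
      ∃ l, wordProd b l = u * v := by
    rintro _ _ ⟨l, rfl⟩ ⟨l', rfl⟩
    exact ⟨l ++ l', wordProd_append l l'⟩
  have hsimple : ∀ j ∈ b.support, ∃ l, wordProd b l = ofIdx P j := fun j hj ↦
    ⟨[⟨j, hj⟩], wordProd_singleton _⟩
  have hrefl : ∀ i, ∃ l, wordProd b l = ofIdx P i := by
    intro i
    refine b.induction_reflect i (p := fun i ↦ ∃ l, wordProd b l = ofIdx P i) ?_ hsimple ?_
    · intro i hi
      rw [ofIdx_reflectionPerm]
      exact hmul _ _ (hmul _ _ hi hi) hi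
    · intro i j hi hj
      rw [ofIdx_reflectionPerm]
      exact hmul _ _ (hmul _ _ (hsimple j hj) hi) (hsimple j hj)
  obtain ⟨w, hw⟩ := w
  induction hw using RootPairing.weylGroup.induction with
  | mem i => exact hrefl i
  | one => exact ⟨[], rfl⟩
  | mul x y hx hy hx' hy' => exact hmul _ _ hx' hy'

theorem isPos_ofIdx_smul {i j : ι} (hi : b.IsPos i) (hj : j ∈ b.support) (hij : i ≠ j) :
    b.IsPos (ofIdx P j • i) :=
  hi.reflectionPerm hj hij

theorem isPos_ofIdx_smul_iff {i j : ι} (hj : j ∈ b.support) (hij : i ≠ j)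
    (hij' : P.root i ≠ -P.root j) : b.IsPos (ofIdx P j • i) ↔ b.IsPos i := by
  refine ⟨fun h ↦ ?_, fun h ↦ isPos_ofIdx_smul h hj hij⟩
  by_contra hi
  obtain ⟨k, hk⟩ := exists_root_neg P i
  have hkp : b.IsPos k := (isPos_neg_iff b hk).2 hi
  have hkj : k ≠ j := by
    rintro rfl
    exact hij' (by rw [hk, neg_neg])
  have := isPos_ofIdx_smul hkp hj hkj
  rw [isPos_neg_iff b (root_smul_eq_neg hk _)] at this
  exact this h

/-- The exchange property. -/
theorem exists_wordProd_mul_ofIdx (l : List b.support) {j : ι} (hj : j ∈ b.support)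
    (h : ¬ b.IsPos (wordProd b l • j)) :
    ∃ l' : List b.support, l'.length + 1 = l.length ∧ wordProd b l' = wordProd b l * ofIdx P j := by
  induction l with
  | nil =>
    refine absurd (RootPairing.Base.isPos_of_mem_support hj) ?_
    simpa [wordProd] using h
  | cons k l ih =>
    by_cases hp : b.IsPos (wordProd b l • j)
    -- The sign changes at the letter `k`, so the tail sends α_j to α_k and conjugation deletes that
    -- letter.
    · have hk : wordProd b l • j = (k : ι) := by
        by_contra hne
        rw [wordProd_cons, mul_smul] at h
        exact h (isPos_ofIdx_smul hp k.2 hne)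
      refine ⟨l, rfl, ?_⟩
      have := ofIdx_wordProd_smul l j
      rw [hk] at this
      rw [wordProd_cons, this, inv_mul_cancel_right, mul_assoc, ofIdx_mul_self, mul_one]
    · obtain ⟨l', hl', hl'2⟩ := ih hp
      exact ⟨k :: l', by simp [hl'], by rw [wordProd_cons, hl'2, wordProd_cons, mul_assoc]⟩

variable (b) in
/-- The positive roots made negative by `w⁻¹`. -/
def invSet (w : P.weylGroup) : Set ι := {i | b.IsPos i ∧ ¬ b.IsPos (w⁻¹ • i)}

theorem invSet_one : invSet b 1 = ∅ := by
  ext i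
  simp [invSet]

/-- A simple reflection permutes the positive roots other than its own, so only wα_j changes status.
-/
theorem invSet_mul_ofIdx {w : P.weylGroup} {j : ι} (hj : j ∈ b.support) (h : b.IsPos (w • j)) :
    invSet b (w * ofIdx P j) = insert (w • j) (invSet b w) := by
  ext i
  simp only [invSet, mem_ofPred_eq, mul_inv_rev, ofIdx_inv, mul_smul, mem_insert_iff]
  by_cases hij : w⁻¹ • i = j
  · have hi : i = w • j := by rw [← hij, smul_inv_smul]
    rw [hij]
    have : ¬ b.IsPos (ofIdx P j • j) := by
      rw [isPos_neg_iff b (root_ofIdx_smul_self j), not_not]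
      exact RootPairing.Base.isPos_of_mem_support hj
    simp [hi, h, this]
  · have hi : i ≠ w • j := fun h ↦ hij (by rw [h, inv_smul_smul])
    simp only [hi, false_or]
    refine and_congr_right fun hip ↦ not_congr (isPos_ofIdx_smul_iff hj hij fun hneg ↦ ?_)
    have := root_smul_eq_neg hneg w
    rw [smul_inv_smul] at this
    exact (isPos_neg_iff b this).1 hip h

theorem ncard_invSet_mul_ofIdx {w : P.weylGroup} {j : ι} (hj : j ∈ b.support)
    (h : b.IsPos (w • j)) : (invSet b (w * ofIdx P j)).ncard = (invSet b w).ncard + 1 := by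
  rw [invSet_mul_ofIdx hj h, ncard_insert_of_notMem _ (toFinite _)]
  simp [invSet, RootPairing.Base.isPos_of_mem_support hj]

theorem ncard_invSet_mul_ofIdx_of_not {w : P.weylGroup} {j : ι} (hj : j ∈ b.support)
    (h : ¬ b.IsPos (w • j)) : (invSet b (w * ofIdx P j)).ncard + 1 = (invSet b w).ncard := by
  have hp : b.IsPos ((w * ofIdx P j) • j) := by
    rw [mul_smul, isPos_neg_iff b (root_smul_eq_neg (root_ofIdx_smul_self j) w)]
    exact h
  have := ncard_invSet_mul_ofIdx hj hp
  rw [mul_assoc, ofIdx_mul_self, mul_one] at this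
  exact this.symm

theorem ncard_invSet_wordProd_le (l : List b.support) :
    (invSet b (wordProd b l)).ncard ≤ l.length := by
  induction l using List.reverseRecOn with
  | nil => simp [wordProd, invSet_one]
  | append_singleton l j ih =>
    rw [wordProd_append, wordProd_singleton, List.length_append, List.length_singleton]
    by_cases h : b.IsPos (wordProd b l • (j : ι))
    · rw [ncard_invSet_mul_ofIdx j.2 h]
      omega
    · have := ncard_invSet_mul_ofIdx_of_not j.2 h
      omega

/-- Each new letter changes the inversion count by one; when the count drops, exchange supplies a
shorter word. -/
theorem exists_wordProd_eq_length_eq (l : List b.support) :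
    ∃ l', wordProd b l' = wordProd b l ∧ l'.length = (invSet b (wordProd b l)).ncard := by
  induction l using List.reverseRecOn with
  | nil => exact ⟨[], rfl, by simp [wordProd, invSet_one]⟩
  | append_singleton l j ih =>
    obtain ⟨l', hl', hlen⟩ := ih
    rw [wordProd_append, wordProd_singleton]
    by_cases h : b.IsPos (wordProd b l • (j : ι))
    · refine ⟨l' ++ [j], ?_, ?_⟩
      · rw [wordProd_append, wordProd_singleton, hl']
      · rw [ncard_invSet_mul_ofIdx j.2 h, List.length_append, hlen, List.length_singleton]
    · rw [← hl'] at h hlen ⊢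
      obtain ⟨l'', h1, h2⟩ := exists_wordProd_mul_ofIdx l' j.2 h
      have := ncard_invSet_mul_ofIdx_of_not j.2 h
      exact ⟨l'', h2, by omega⟩

/-- The length of `w` is its number of inversions. -/
theorem sInf_length_eq_ncard_invSet (w : P.weylGroup) :
    sInf {n | ∃ l : List b.support, l.length = n ∧ wordProd b l = w} = (invSet b w).ncard := by
  obtain ⟨l, rfl⟩ := exists_wordProd_eq b w
  obtain ⟨l', hl', hlen⟩ := exists_wordProd_eq_length_eq l
  refine le_antisymm (Nat.sInf_le ⟨l', hlen, hl'⟩) ?_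
  refine le_csInf ⟨_, l', hlen, hl'⟩ ?_
  rintro n ⟨m, rfl, hm⟩
  rw [← hm]
  exact ncard_invSet_wordProd_le m

theorem eq_one_of_invSet_eq_empty {w : P.weylGroup} (h : invSet b w = ∅) : w = 1 := by
  obtain ⟨l, rfl⟩ := exists_wordProd_eq b w
  obtain ⟨l', hl', hlen⟩ := exists_wordProd_eq_length_eq l
  rw [h, ncard_empty, List.length_eq_zero_iff] at hlen
  rw [← hl', hlen]
  simp [wordProd]

theorem ncard_invSet_ofIdx_mul_lt {w : P.weylGroup} {j : ι} (hj : j ∈ b.support)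
    (h : ¬ b.IsPos (w⁻¹ • j)) : (invSet b (ofIdx P j * w)).ncard < (invSet b w).ncard := by
  have hjp : b.IsPos j := RootPairing.Base.isPos_of_mem_support hj
  have hsub : (fun i ↦ ofIdx P j • i) '' invSet b (ofIdx P j * w) ⊆ invSet b w \ {j} := by
    rintro _ ⟨i, ⟨hi, hi'⟩, rfl⟩
    rw [mul_inv_rev, ofIdx_inv, mul_smul] at hi'
    have hij : i ≠ j := by
      rintro rfl
      rw [isPos_neg_iff b (root_smul_eq_neg (root_ofIdx_smul_self i) w⁻¹)] at hi'
      exact hi' h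
    refine ⟨⟨isPos_ofIdx_smul hi hj hij, hi'⟩, fun hj' ↦ ?_⟩
    have hj'' : ofIdx P j • i = j := hj'
    have : i = ofIdx P j • j := by
      rw [← inv_smul_eq_iff, ofIdx_inv, hj'']
    rw [this, isPos_neg_iff b (root_ofIdx_smul_self j)] at hi
    exact hi hjp
  have h1 := ncard_le_ncard hsub (toFinite _)
  rw [ncard_image_of_injective _ (MulAction.injective _)] at h1
  have h2 := ncard_sdiff_singleton_lt_of_mem (show j ∈ invSet b w from ⟨hjp, h⟩) (toFinite _)
  omega

end Length

/-! ### Minimal coset representatives and their inversion sets -/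

section Parabolic

variable {ι R M N : Type*} [Finite ι] [Field R] [CharZero R] [AddCommGroup M] [Module R M]
  [AddCommGroup N] [Module R N] {P : RootPairing ι R M N} [P.IsCrystallographic] [P.IsReduced]
  [P.IsRootSystem] {b : P.Base} {i : ι}

open RootPairing.weylGroup (ofIdx)

theorem isPos_of_coeff_pos {α : ι} (h : 0 < coeff b i α) : b.IsPos α := by
  by_contra hα
  exact absurd (coeff_nonpos b hα i) (by omega)

theorem isPos_inv_smul_iff {w : P.weylGroup} (hi : i ∈ b.support)
    (hw : ∀ α ∈ invSet b w, coeff b i α = 1) {α : ι} (hα : coeff b i α = 0) :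
    b.IsPos (w⁻¹ • α) ↔ b.IsPos α := by
  have key : ∀ β, coeff b i β = 0 → b.IsPos β → b.IsPos (w⁻¹ • β) := by
    intro β hβ hp
    by_contra h
    have := hw β ⟨hp, h⟩
    omega
  refine ⟨fun h ↦ ?_, key α hα⟩
  by_contra hn
  obtain ⟨β, hβ⟩ := exists_root_neg P α
  have := key β (by rw [(coeff_isLinear b hi).neg_eq hβ, hα, neg_zero])
    ((isPos_neg_iff b hβ).2 hn)
  rw [isPos_neg_iff b (root_smul_eq_neg hβ _)] at this
  exact this h

/-- Otherwise w⁻¹α would be a sum of two positive roots, as w⁻¹ preserves signs in degree zero. -/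
theorem mem_invSet_of_eq_add {w : P.weylGroup} (hi : i ∈ b.support)
    (hw : ∀ α ∈ invSet b w, coeff b i α = 1) {α β γ : ι} (hα : α ∈ invSet b w)
    (hβ : b.IsPos β) (hβ0 : coeff b i β = 0) (h : P.root α = P.root γ + P.root β) :
    γ ∈ invSet b w := by
  have h1 := (coeff_isLinear b hi).add_eq h
  have h2 := hw α hα
  refine ⟨isPos_of_coeff_pos (b := b) (i := i) (by omega), fun hγ ↦ ?_⟩
  exact hα.2 (hγ.add ((isPos_inv_smul_iff hi hw hβ0).2 hβ) (root_smul_eq_add h _))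

/-- Minimality makes w⁻¹α_j positive for j ≠ i, so w⁻¹ sends positive roots of degree zero to
nonnegative combinations of positive roots. -/
theorem coeff_eq_one_of_mem_invSet {w : P.weylGroup} (hi : i ∈ b.support)
    (hc : ∀ α, coeff b i α ≤ 1)
    (hmin : ∀ j ∈ b.support, j ≠ i → (invSet b w).ncard ≤ (invSet b (ofIdx P j * w)).ncard) :
    ∀ α ∈ invSet b w, coeff b i α = 1 := by
  intro α hα
  have h1 := coeff_nonneg b hα.1 i
  have h2 := hc α
  by_contra h3
  refine hα.2 (b.isPos_iff'.2 ?_)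
  rw [((height_isLinear b).smul w⁻¹).eq_sum b α]
  refine Finset.sum_nonneg fun j hj ↦ ?_
  by_cases hji : j = i
  · subst hji
    rw [(by omega : coeff b j α = 0), zero_mul]
  · refine mul_nonneg (coeff_nonneg b hα.1 j) ?_
    have : b.IsPos (w⁻¹ • j) := by
      by_contra hn
      exact absurd (ncard_invSet_ofIdx_mul_lt hj hn) (not_lt.2 (hmin j hj hji))
    exact (b.isPos_iff'.1 this)

theorem ncard_invSet_le_mul {u w : P.weylGroup} (hw : ∀ α ∈ invSet b w, coeff b i α = 1)
    (hu : ∀ α, coeff b i (u • α) = coeff b i α) :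
    (invSet b w).ncard ≤ (invSet b (u * w)).ncard := by
  rw [← ncard_image_of_injective _ (MulAction.injective u)]
  refine ncard_le_ncard ?_ (toFinite _)
  rintro _ ⟨α, hα, rfl⟩
  refine ⟨isPos_of_coeff_pos (b := b) (i := i) (by rw [hu, hw α hα]; omega), ?_⟩
  rw [mul_inv_rev, mul_smul, inv_smul_smul]
  exact hα.2

theorem coeff_smul_of_mem_closure (hi : i ∈ b.support) {u : P.weylGroup}
    (hu : u ∈ Subgroup.closure (ofIdx P '' {α | coeff b i α = 0})) (α : ι) :
    coeff b i (u • α) = coeff b i α := by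
  induction hu using Subgroup.closure_induction generalizing α with
  | mem x hx =>
    obtain ⟨k, hk, rfl⟩ := hx
    obtain ⟨F, hF⟩ := coeff_isLinear b hi
    have h1 : P.root (ofIdx P k • α) = P.root α - P.pairing α k • P.root k := by
      change P.root (P.reflectionPerm k α) = _
      rw [P.root_reflectionPerm, P.reflection_apply_root]
    have h2 := congrArg F h1
    rw [map_sub, LinearMap.map_smul, hF, hF, hF, show coeff b i k = 0 from hk] at h2
    simpa using h2
  | one => rw [one_smul]
  | mul x y _ _ hx hy => rw [mul_smul, hx, hy]
  | inv x _ hx => rw [← hx, smul_inv_smul]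

/-- A set of roots of degree one that is closed under subtraction of positive roots of degree zero
is an inversion set. -/
theorem exists_invSet_eq (hi : i ∈ b.support) (hc : ∀ α, coeff b i α ≤ 1) (Φ : Set ι)
    (hΦ : ∀ α ∈ Φ, coeff b i α = 1)
    (hlow : ∀ α ∈ Φ, ∀ β γ, b.IsPos β → coeff b i β = 0 → P.root α = P.root γ + P.root β → γ ∈ Φ) :
    ∃ v : P.weylGroup, invSet b v = Φ := by
  generalize hn : Φ.ncard = n
  induction n generalizing Φ with
  | zero =>
    rw [ncard_eq_zero (toFinite _)] at hn
    exact ⟨1, by rw [invSet_one, hn]⟩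
  | succ n ih =>
    have hne : Φ.Nonempty := by
      rw [← ncard_pos (toFinite _)]
      omega
    -- By maximal height, β is never another member of Φ minus a positive root, so Φ \ {β} is still
    -- closed.
    obtain ⟨β, hβ, hmax⟩ := (toFinite Φ).exists_maximalFor b.height Φ hne
    have hlin := coeff_isLinear b hi
    obtain ⟨v, hv⟩ := ih (Φ \ {β}) (fun α hα ↦ hΦ α hα.1) (by
      intro α hα γ δ hγ hγ0 h
      refine ⟨hlow α hα.1 γ δ hγ hγ0 h, ?_⟩
      rintro rfl
      have h1 := b.height_add h
      have h2 : 0 < b.height γ := hγ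
      have := hmax hα.1 (by omega)
      omega) (by
      rw [ncard_sdiff_singleton_of_mem hβ, hn]; rfl)
    have hβp : b.IsPos β := isPos_of_coeff_pos (b := b) (i := i) (by rw [hΦ β hβ]; omega)
    have hβv : b.IsPos (v⁻¹ • β) := by
      by_contra h
      have : β ∈ invSet b v := ⟨hβp, h⟩
      rw [hv] at this
      exact this.2 rfl
    have hneg : ∀ γ, b.IsPos γ → ¬ b.IsPos (v • γ) → coeff b i (v • γ) = -1 := by
      intro γ hγ hvγ
      obtain ⟨δ, hδ⟩ := exists_root_neg P (v • γ)
      have hmem : δ ∈ invSet b v := by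
        refine ⟨(isPos_neg_iff b hδ).2 hvγ, ?_⟩
        have := root_smul_eq_neg hδ v⁻¹
        rw [inv_smul_smul] at this
        rw [isPos_neg_iff b this, not_not]
        exact hγ
      rw [hv] at hmem
      have h1 := hΦ δ hmem.1
      have h2 := hlin.neg_eq hδ
      omega
    -- If vγ had degree zero it would be positive by `hneg`; closure would put vδ in Φ \ {β}, making
    -- δ negative.
    have hone : ∀ γ δ, b.IsPos γ → b.IsPos δ → P.root β = P.root (v • γ) + P.root (v • δ) →
        coeff b i (v • γ) ≠ 0 := by
      intro γ δ hγ hδ h h0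
      have h1 := hlin.add_eq h
      have h2 := hΦ β hβ
      have hγp : b.IsPos (v • γ) := by
        by_contra hn
        have := hneg γ hγ hn
        omega
      have hmem := hlow β hβ _ (v • δ) hγp h0 (by rw [h]; abel)
      have hne : v • δ ≠ β := by
        intro h'
        rw [h', right_eq_add] at h
        exact P.ne_zero _ h
      have : v • δ ∈ invSet b v := by
        rw [hv]
        exact ⟨hmem, hne⟩
      exact this.2 (by rwa [inv_smul_smul])
    -- Two nonzero degrees at most 1 cannot add up to 1, so v⁻¹β is indecomposable.
    have hsimple : v⁻¹ • β ∈ b.support := by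
      by_contra hns
      obtain ⟨γ, δ, hγ, hδ, h⟩ := exists_eq_add_simple hβv hns
      replace hδ : b.IsPos δ := RootPairing.Base.isPos_of_mem_support hδ
      have h' := root_smul_eq_add h v
      rw [smul_inv_smul] at h'
      have h1 := hone γ δ hγ hδ h'
      have h2 := hone δ γ hδ hγ (by rw [h']; abel)
      have h3 := hlin.add_eq h'
      have h4 := hΦ β hβ
      have h5 := hc (v • γ)
      have h6 := hc (v • δ)
      omega
    refine ⟨v * ofIdx P (v⁻¹ • β), ?_⟩
    rw [invSet_mul_ofIdx hsimple (by rwa [smul_inv_smul]), smul_inv_smul, hv, insert_sdiff_singleton,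
      insert_eq_of_mem hβ]

end Parabolic

/-! ### The marking read off from the twisted degree -/

section Marking

variable {ι R M N : Type*} [Finite ι] [Field R] [CharZero R] [AddCommGroup M] [Module R M]
  [AddCommGroup N] [Module R N] {P : RootPairing ι R M N} [P.IsCrystallographic] [P.IsReduced]
  [P.IsRootSystem]

variable (b : P.Base) (i : ι) (w : P.weylGroup)

/-- The simple roots `α_j`, `j ≠ i`, that can be added to some inversion of `w` so as to obtain a
root that is not an inversion of `w`. -/
def markSet : Set ι :=
  {j | j ∈ b.support ∧ j ≠ i ∧ ∃ α ∈ invSet b w, ∃ β, β ∉ invSet b w ∧ P.root β = P.root α + P.root j}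

open Classical in
/-- The sum of the coefficients of a root at the simple roots in `markSet`. -/
def markDegree (α : ι) : ℤ := ∑ j ∈ b.support with j ∈ markSet b i w, coeff b j α

open Classical in
/-- The sum of the coefficients of a root at the simple roots `α_k` such that `w α_k` has nonzero
coefficient at `α_i`. -/
def twistDegree (α : ι) : ℤ := ∑ k ∈ b.support with coeff b i (w • k) ≠ 0, coeff b k α

open Classical in
theorem markDegree_isLinear : IsLinear P (markDegree b i w) :=
  IsLinear.sum _ fun _ hj ↦ coeff_isLinear b (Finset.mem_filter.1 hj).1

open Classical in
theorem twistDegree_isLinear : IsLinear P (twistDegree b i w) :=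
  IsLinear.sum _ fun _ hj ↦ coeff_isLinear b (Finset.mem_filter.1 hj).1

open Classical in
theorem markDegree_simple {j : ι} (hj : j ∈ b.support) :
    markDegree b i w j = if j ∈ markSet b i w then 1 else 0 := by
  have : ∀ k ∈ b.support.filter (· ∈ markSet b i w), coeff b k j = if k = j then 1 else 0 :=
    fun k hk ↦ coeff_simple b (Finset.mem_filter.1 hk).1 hj
  rw [markDegree, Finset.sum_congr rfl this, Finset.sum_ite_eq']
  simp [hj]

open Classical in
theorem twistDegree_simple {j : ι} (hj : j ∈ b.support) :
    twistDegree b i w j = if coeff b i (w • j) ≠ 0 then 1 else 0 := by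
  have : ∀ k ∈ b.support.filter (fun k ↦ coeff b i (w • k) ≠ 0),
      coeff b k j = if k = j then 1 else 0 :=
    fun k hk ↦ coeff_simple b (Finset.mem_filter.1 hk).1 hj
  rw [twistDegree, Finset.sum_congr rfl this, Finset.sum_ite_eq']
  simp [hj]

variable {b i w}

theorem isGrading_twistDegree (hi : i ∈ b.support) (hc : ∀ α, coeff b i α ≤ 1) :
    IsGrading b (fun α ↦ coeff b i (w • α)) (twistDegree b i w) where
  linear := (coeff_isLinear b hi).smul w
  linear_degree := twistDegree_isLinear b i w
  neg_one_le α := by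
    obtain ⟨β, hβ⟩ := exists_root_neg P (w • α)
    have h1 := (coeff_isLinear b hi).neg_eq hβ
    have h2 := hc β
    omega
  le_one α := hc _
  degree_of_eq_zero k hk h := by
    rw [twistDegree_simple b i w hk, if_neg (by simpa using h)]
  degree_of_ne_zero k hk h := by
    rw [twistDegree_simple b i w hk, if_pos h]

/-- As E = 1 at w⁻¹α, the degree d is nonzero there and has the sign of that root. -/
theorem mem_invSet_iff_twistDegree_neg (hi : i ∈ b.support) (hc : ∀ α, coeff b i α ≤ 1) {α : ι}
    (hα : coeff b i α = 1) : α ∈ invSet b w ↔ twistDegree b i w (w⁻¹ • α) < 0 := by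
  have hg := isGrading_twistDegree (w := w) hi hc
  constructor
  · rintro ⟨-, h⟩
    obtain ⟨β, hβ⟩ := exists_root_neg P (w⁻¹ • α)
    have h1 := hg.linear.neg_eq hβ
    simp only [smul_inv_smul] at h1
    have h2 := hg.degree_pos ((isPos_neg_iff b hβ).2 h) (by omega)
    have h3 := hg.linear_degree.neg_eq hβ
    omega
  · intro h
    refine ⟨isPos_of_coeff_pos (b := b) (i := i) (by omega), fun hp ↦ ?_⟩
    have := hg.degree_nonneg hp
    omega

/-- A value above 2 would decompose α_j into positive roots. The value 1 is impossible: a splitting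
of w⁻¹α_j with E = -1 and E = 1 gives each half degree at least 1. -/
theorem twistDegree_inv_smul_simple (hi : i ∈ b.support) (hc : ∀ α, coeff b i α ≤ 1)
    (hw : ∀ α ∈ invSet b w, coeff b i α = 1) {j : ι} (hj : j ∈ b.support) (hji : j ≠ i) :
    twistDegree b i w (w⁻¹ • j) = 2 * markDegree b i w j := by
  classical
  have hg := isGrading_twistDegree (w := w) hi hc
  have hj0 : coeff b i j = 0 := by rw [coeff_simple b hi hj, if_neg (Ne.symm hji)]
  have hjp : b.IsPos j := RootPairing.Base.isPos_of_mem_support hj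
  have hp : b.IsPos (w⁻¹ • j) := (isPos_inv_smul_iff hi hw hj0).2 hjp
  have hE : coeff b i (w • w⁻¹ • j) = 0 := by rw [smul_inv_smul, hj0]
  have hnn := hg.degree_nonneg hp
  have hle : twistDegree b i w (w⁻¹ • j) ≤ 2 := by
    by_contra! hlt
    obtain ⟨x, y, hx, hy, hxy, hEx, hEy⟩ := hg.exists_add_of_two_lt hp hE hlt
    have h1 := root_smul_eq_add hxy w
    rw [smul_inv_smul] at h1
    have hx' : 0 < b.height (w • x) := by
      rw [← inv_smul_smul w x, isPos_inv_smul_iff hi hw hEx] at hx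
      exact hx
    have hy' : 0 < b.height (w • y) := by
      rw [← inv_smul_smul w y, isPos_inv_smul_iff hi hw hEy] at hy
      exact hy
    have h2 := b.height_add h1
    rw [RootPairing.Base.height_one_of_mem_support hj] at h2
    omega
  rw [markDegree_simple b i w hj]
  split_ifs with hm
  · obtain ⟨-, -, α, hα, β, hβ, hαβ⟩ := hm
    have h1 := (coeff_isLinear b hi).add_eq hαβ
    have h2 := hw α hα
    have h3 := (mem_invSet_iff_twistDegree_neg hi hc h2).1 hα
    have h4 := mt (mem_invSet_iff_twistDegree_neg hi hc (by omega)).2 hβ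
    have h5 := hg.linear_degree.add_eq (root_smul_eq_add hαβ w⁻¹)
    have h6 : twistDegree b i w (w⁻¹ • j) ≠ 1 := by
      intro h6
      obtain ⟨x, y, hx, hy, hxy, hEx, hEy⟩ := hg.exists_add_of_eq_zero hp hE (by omega)
      have h7 := hg.degree_pos hx (by omega)
      have h8 := hg.degree_pos hy (by omega)
      have h9 := hg.linear_degree.add_eq hxy
      omega
    omega
  · by_contra h0
    -- Then -wx is an inversion, and adding α_j to it gives wy, which is not: α_j would be marked.
    obtain ⟨x, y, hx, hy, hxy, hEx, hEy⟩ := hg.exists_add_of_eq_zero hp hE (by omega)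
    obtain ⟨α, hα⟩ := exists_root_neg P (w • x)
    have h1 := root_smul_eq_add hxy w
    rw [smul_inv_smul] at h1
    have h2 := (coeff_isLinear b hi).neg_eq hα
    have h3 := root_smul_eq_neg hα w⁻¹
    rw [inv_smul_smul] at h3
    refine hm ⟨hj, hji, α, ⟨isPos_of_coeff_pos (b := b) (i := i) (by omega), ?_⟩, w • y, ?_, ?_⟩
    · rw [isPos_neg_iff b h3, not_not]
      exact hx
    · rintro ⟨-, h⟩
      rw [inv_smul_smul] at h
      exact h hy
    · rw [h1, hα]
      abel

theorem twistDegree_inv_smul (hi : i ∈ b.support) (hc : ∀ α, coeff b i α ≤ 1)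
    (hw : ∀ α ∈ invSet b w, coeff b i α = 1) (α : ι) :
    twistDegree b i w (w⁻¹ • α) =
      coeff b i α * twistDegree b i w (w⁻¹ • i) + 2 * markDegree b i w α := by
  classical
  have hmi : markDegree b i w i = 0 := by
    rw [markDegree_simple b i w hi, if_neg]
    exact fun h ↦ h.2.1 rfl
  rw [((twistDegree_isLinear b i w).smul w⁻¹).eq_sum b α, (markDegree_isLinear b i w).eq_sum b α,
    ← Finset.add_sum_erase _ _ hi, ← Finset.add_sum_erase _ _ hi, hmi, mul_zero, zero_add,
    Finset.mul_sum]
  congr 1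
  refine Finset.sum_congr rfl fun j hj ↦ ?_
  rw [Finset.mem_erase] at hj
  rw [twistDegree_inv_smul_simple hi hc hw hj.2 hj.1]
  ring

/-- E is positive at the negative root w⁻¹α, hence negative at some simple α_k; the witness is
-wα_k. -/
theorem exists_twistDegree_eq_neg_one (hi : i ∈ b.support) (hc : ∀ α, coeff b i α ≤ 1)
    (hw : ∀ α ∈ invSet b w, coeff b i α = 1) (hne : (invSet b w).Nonempty) :
    ∃ α ∈ invSet b w, twistDegree b i w (w⁻¹ • α) = -1 := by
  have hg := isGrading_twistDegree (w := w) hi hc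
  obtain ⟨α, hα⟩ := hne
  obtain ⟨k, hk, hk'⟩ : ∃ k ∈ b.support, coeff b i (w • k) < 0 := by
    by_contra! h
    have h1 := hg.linear.eq_sum b (w⁻¹ • α)
    simp only [smul_inv_smul] at h1
    have h2 : ∑ k ∈ b.support, coeff b k (w⁻¹ • α) * coeff b i (w • k) ≤ 0 :=
      Finset.sum_nonpos fun k hk ↦
        mul_nonpos_of_nonpos_of_nonneg (coeff_nonpos b hα.2 k) (h k hk)
    have h3 := hw α hα
    omega
  obtain ⟨β, hβ⟩ := exists_root_neg P (w • k)
  have h1 := (coeff_isLinear b hi).neg_eq hβ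
  have h2 := hc β
  have h3 := root_smul_eq_neg hβ w⁻¹
  rw [inv_smul_smul] at h3
  have h4 := hg.linear_degree.neg_eq h3
  rw [hg.degree_of_ne_zero k hk (by omega)] at h4
  exact ⟨β, (mem_invSet_iff_twistDegree_neg hi hc (by omega)).2 (by omega), h4⟩

theorem exists_add_simple_of_add (hi : i ∈ b.support) {x δ : ι} (hx : coeff b i x = 1)
    (hδ : b.IsPos δ) (hδ0 : coeff b i δ = 0) (hy : ∃ y, P.root y = P.root δ + P.root x) :
    ∃ j ∈ b.support, coeff b i j = 0 ∧ ∃ z, P.root z = P.root x + P.root j := by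
  revert hδ0 hy
  refine isPos_induction hδ ?_ ?_
  · intro k hk hk0 ⟨y, hy⟩
    exact ⟨k, hk, hk0, y, by rw [hy]; abel⟩
  · intro δ' l δ hδ' hl hδ ih hδ0 ⟨y, hy⟩
    have hlin := coeff_isLinear b hi
    have h1 := hlin.add_eq hδ
    have h2 := coeff_nonneg b hδ' i
    have h3 := coeff_nonneg b (RootPairing.Base.isPos_of_mem_support hl) i
    have hne : ∀ k, coeff b i k = 0 → P.root k + P.root x ≠ 0 := by
      intro k hk h
      have := hlin.neg_eq (eq_neg_of_add_eq_zero_right h)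
      omega
    rcases root_add_mem_or_root_add_mem hδ hy (hne _ (by omega)) (hne _ (by omega)) with
      ⟨m, hm⟩ | ⟨m, hm⟩
    · exact ih (by omega) ⟨m, hm⟩
    · exact ⟨l, hl, by omega, m, by rw [hm]; abel⟩

/-- The positive root -w⁻¹x splits as δ + β with E(δ) = 0, so x + wδ = -wβ is a root with wδ
positive of degree zero; a simple root then suffices. -/
theorem exists_add_simple_of_twistDegree_lt (hi : i ∈ b.support) (hc : ∀ α, coeff b i α ≤ 1)
    (hw : ∀ α ∈ invSet b w, coeff b i α = 1) {x : ι} (hx : coeff b i x = 1)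
    (hd : twistDegree b i w (w⁻¹ • x) < -1) :
    ∃ j ∈ b.support, coeff b i j = 0 ∧ ∃ z, P.root z = P.root x + P.root j := by
  have hg := isGrading_twistDegree (w := w) hi hc
  have hxw := (mem_invSet_iff_twistDegree_neg (w := w) hi hc hx).2 (by omega)
  obtain ⟨ξ, hξ⟩ := exists_root_neg P (w⁻¹ • x)
  have h1 := hg.linear.neg_eq hξ
  simp only [smul_inv_smul] at h1
  have h2 := hg.linear_degree.neg_eq hξ
  obtain ⟨δ, β, hδ, hβ, hδβ, hEδ, -, hEβ⟩ := hg.neg.exists_add_of_eq_one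
    ((isPos_neg_iff b hξ).2 hxw.2) (by simp only [Pi.neg_apply]; omega) (by omega)
  simp only [Pi.neg_apply, neg_eq_zero] at hEδ hEβ
  obtain ⟨y, hy⟩ := exists_root_neg P (w • β)
  have hδp : b.IsPos (w • δ) := by
    rwa [← inv_smul_smul w δ, isPos_inv_smul_iff hi hw hEδ] at hδ
  refine exists_add_simple_of_add hi hx hδp hEδ ⟨y, ?_⟩
  have h3 := root_smul_eq_add hδβ w
  have h4 := root_smul_eq_neg hξ w
  rw [smul_inv_smul, h3, eq_neg_iff_add_eq_zero] at h4
  rw [hy, neg_eq_iff_add_eq_zero, ← h4]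
  abel

end Marking

/-! ### Removing Δ(w, ε) and finding a missing ε -/

section Removal

variable {ι R M N : Type*} [Finite ι] [Field R] [CharZero R] [AddCommGroup M] [Module R M]
  [AddCommGroup N] [Module R N] {P : RootPairing ι R M N} [P.IsCrystallographic] [P.IsReduced]
  [P.IsRootSystem]

section

variable (b : P.Base) (i : ι) (w : P.weylGroup) (a : ℤ)

/-- The roots of bidegree `(1, a - 1)` to which no positive root of bidegree `(0, 0)` can be
added. -/
def topSet : Set ι :=
  {ε | coeff b i ε = 1 ∧ markDegree b i w ε = a - 1 ∧ ∀ α, b.IsPos α → coeff b i α = 0 →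
    markDegree b i w α = 0 → P.root ε + P.root α ∉ range P.root}

/-- The root `ε` together with the roots of bidegree `(1, a)` obtained from `ε` by adding a root of
bidegree `(0, 1)`. -/
def removedSet (ε : ι) : Set ι :=
  {ε} ∪ {ν | coeff b i ν = 1 ∧ markDegree b i w ν = a ∧ ∃ β, coeff b i β = 0 ∧
    markDegree b i w β = 1 ∧ P.root ν - P.root ε = P.root β}

end

variable {b : P.Base} {i : ι} {w : P.weylGroup} {a : ℤ}

theorem isPos_of_markDegree_pos {α : ι} (h : 0 < markDegree b i w α) : b.IsPos α := by
  classical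
  by_contra hα
  have : markDegree b i w α ≤ 0 := Finset.sum_nonpos fun j _ ↦ coeff_nonpos b hα j
  omega

theorem markDegree_nonneg {α : ι} (h : b.IsPos α) : 0 ≤ markDegree b i w α := by
  classical
  exact Finset.sum_nonneg fun j _ ↦ coeff_nonneg b h j

/-- On degree one the value is c + 2 `markDegree`. It is negative at level a and equals -1 at some
level at most a, so c + 2a = -1. -/
theorem twistDegree_inv_smul_eq (hi : i ∈ b.support) (hc : ∀ α, coeff b i α ≤ 1)
    (hw : ∀ α ∈ invSet b w, coeff b i α = 1)
    (ha : IsGreatest (markDegree b i w '' invSet b w) a) {α : ι} (hα : coeff b i α = 1) :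
    twistDegree b i w (w⁻¹ • α) = 2 * (markDegree b i w α - a) - 1 := by
  obtain ⟨⟨β, hβ, rfl⟩, hle⟩ := ha
  obtain ⟨γ, hγ, hγ1⟩ := exists_twistDegree_eq_neg_one hi hc hw ⟨β, hβ⟩
  have h1 := twistDegree_inv_smul hi hc hw α
  have h2 := twistDegree_inv_smul hi hc hw β
  have h3 := twistDegree_inv_smul hi hc hw γ
  rw [hw β hβ] at h2
  rw [hw γ hγ] at h3
  rw [hα] at h1
  have h4 := (mem_invSet_iff_twistDegree_neg hi hc (hw β hβ)).1 hβ
  have h5 := hle (mem_image_of_mem _ hγ)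
  omega

theorem mem_invSet_iff_markDegree_le (hi : i ∈ b.support) (hc : ∀ α, coeff b i α ≤ 1)
    (hw : ∀ α ∈ invSet b w, coeff b i α = 1)
    (ha : IsGreatest (markDegree b i w '' invSet b w) a) {α : ι} (hα : coeff b i α = 1) :
    α ∈ invSet b w ↔ markDegree b i w α ≤ a := by
  rw [mem_invSet_iff_twistDegree_neg hi hc hα, twistDegree_inv_smul_eq hi hc hw ha hα]
  omega

theorem exists_invSet_eq_sdiff (hi : i ∈ b.support) (hc : ∀ α, coeff b i α ≤ 1)
    (hw : ∀ α ∈ invSet b w, coeff b i α = 1)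
    (ha : IsGreatest (markDegree b i w '' invSet b w) a) {ε : ι} (hε : ε ∈ topSet b i w a) :
    ∃ v, invSet b v = invSet b w \ removedSet b i w a ε := by
  refine exists_invSet_eq hi hc _ (fun α hα ↦ hw α hα.1) ?_
  rintro α ⟨hα, hαε⟩ β γ hβ hβ0 h
  have hlin := coeff_isLinear b hi
  have hlin' := markDegree_isLinear b i w
  obtain ⟨hε1, hεa, hεtop⟩ := hε
  refine ⟨mem_invSet_of_eq_add hi hw hα hβ hβ0 h, ?_⟩
  have h0 := hw α hα
  have h1 := hlin'.add_eq h
  have h2 := (mem_invSet_iff_markDegree_le hi hc hw ha h0).1 hα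
  have h3 := markDegree_nonneg (i := i) (w := w) hβ
  rintro (hγ | ⟨hγ1, hγa, δ, hδ0, hδ1, hδ⟩)
  · obtain rfl : γ = ε := hγ
    rcases (by omega : markDegree b i w β = 0 ∨ markDegree b i w β = 1) with h4 | h4
    · exact hεtop β hβ hβ0 h4 ⟨α, h⟩
    · exact hαε (.inr ⟨h0, by omega, β, hβ0, h4, by rw [h]; abel⟩)
  · have h4 : markDegree b i w β = 0 := by omega
    have h5 : P.root γ = P.root ε + P.root δ := by rw [← hδ]; abel
    have hδp : b.IsPos δ := isPos_of_markDegree_pos (i := i) (w := w) (by omega)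
    have hεp : b.IsPos ε := isPos_of_coeff_pos (b := b) (i := i) (by omega)
    -- Now α = ε + δ + β with β of bidegree (0, 0). Since ε + β is not a root, δ + β is one, of
    -- bidegree (0, 1), and α was removed.
    rcases root_add_mem_or_root_add_mem h5 h (root_add_root_ne_zero hεp hβ)
      (root_add_root_ne_zero hδp hβ) with ⟨m, hm⟩ | ⟨m, hm⟩
    · exact hεtop β hβ hβ0 h4 ⟨m, hm⟩
    · have h6 := hlin.add_eq hm
      have h7 := hlin'.add_eq hm
      exact hαε (.inr ⟨h0, by omega, m, by omega, by omega, by rw [h, h5, hm]; abel⟩)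

theorem disjoint_removedSet (hi : i ∈ b.support) {v : P.weylGroup}
    (hv : ∀ α ∈ invSet b v, coeff b i α = 1) {ε : ι} (hε : ε ∉ invSet b v) :
    Disjoint (invSet b v) (removedSet b i w a ε) := by
  rw [Set.disjoint_left]
  rintro ν hν (rfl | ⟨-, -, β, hβ0, hβ1, hβ⟩)
  · exact hε hν
  · refine hε (mem_invSet_of_eq_add hi hv hν (isPos_of_markDegree_pos (i := i) (w := w) ?_) hβ0 ?_)
    · omega
    · rw [← hβ]
      abel

theorem exists_mem_topSet (hi : i ∈ b.support) (hc : ∀ α, coeff b i α ≤ 1)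
    (hw : ∀ α ∈ invSet b w, coeff b i α = 1)
    (ha : IsGreatest (markDegree b i w '' invSet b w) a) {v : P.weylGroup}
    (hv : ∀ α ∈ invSet b v, coeff b i α = 1) {x : ι} (hx : x ∈ invSet b w) (hxv : x ∉ invSet b v)
    (hxa : markDegree b i w x ≠ a) : ∃ ε ∈ topSet b i w a, ε ∉ invSet b v := by
  classical
  have hlin := coeff_isLinear b hi
  have hlin' := markDegree_isLinear b i w
  set S : Set ι := {x | coeff b i x = 1 ∧ markDegree b i w x ≤ a - 1 ∧ x ∉ invSet b v}
  have hxS : x ∈ S := by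
    have h1 := (mem_invSet_iff_markDegree_le hi hc hw ha (hw x hx)).1 hx
    exact ⟨hw x hx, by omega, hxv⟩
  obtain ⟨ε, ⟨hε1, hεa, hεv⟩, hmax⟩ := (toFinite S).exists_maximalFor b.height S ⟨x, hxS⟩
  have key : ∀ y β, b.IsPos β → coeff b i β = 0 → P.root y = P.root ε + P.root β →
      ¬ markDegree b i w y ≤ a - 1 := by
    intro y β hβ hβ0 hy hya
    have h1 := hlin.add_eq hy
    have h2 := b.height_add hy
    have h3 : 0 < b.height β := hβ
    have h4 := hmax (j := y)
      ⟨by omega, hya, fun hyv ↦ hεv (mem_invSet_of_eq_add hi hv hyv hβ hβ0 hy)⟩ (by omega)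
    omega
  refine ⟨ε, ⟨hε1, ?_, ?_⟩, hεv⟩
  · by_contra hne
    have h1 := twistDegree_inv_smul_eq hi hc hw ha hε1
    -- A simple root raises the level by at most 1, so from below a - 1 the sum stays in the range
    -- where ε has maximal height.
    obtain ⟨j, hj, hj0, y, hy⟩ := exists_add_simple_of_twistDegree_lt hi hc hw hε1 (by omega)
    refine key y j (RootPairing.Base.isPos_of_mem_support hj) hj0 hy ?_
    rw [hlin'.add_eq hy, markDegree_simple b i w hj]
    split_ifs <;> omega
  · rintro α hα hα0 hα1 ⟨y, hy⟩
    refine key y α hα hα0 hy ?_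
    rw [hlin'.add_eq hy]
    omega

end Removal

/-! ### From root spaces to root combinatorics -/

section Lie

variable {L : Type*} [LieRing L] [LieAlgebra ℂ L] [FiniteDimensional ℂ L] [LieAlgebra.IsSimple ℂ L]
  {H : LieSubalgebra ℂ L} [H.IsCartanSubalgebra]

/-- If `α`, `β` and `α + β` are roots then `[𝔤_α, 𝔤_β]` does not vanish. -/
theorem lie_ne_zero_of_add_ne_bot {α β : Weight ℂ H L} (hα : α.IsNonZero) (hβ : β.IsNonZero)
    (hαβ : rootSpace H (α + β : H → ℂ) ≠ ⊥) {x y : L} (hx : x ∈ rootSpace H α)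
    (hy : y ∈ rootSpace H β) (hx0 : x ≠ 0) (hy0 : y ≠ 0) : ⁅x, y⁆ ≠ 0 := by
  obtain ⟨h, e, f, isSl2, he, hf⟩ := exists_isSl2Triple_of_weight_isNonZero hα
  obtain rfl := isSl2.h_eq_coroot hα he hf
  obtain ⟨t, ht, ht0⟩ := (chainTop α β).exists_ne_zero
  have prim : isSl2.HasPrimitiveVectorWith t (chainLength α β : ℂ) :=
    have := lie_mem_genWeightSpace_of_mem_genWeightSpace he ht
    ⟨ht0, (chainLength_smul _ _ ht).symm, by rwa [genWeightSpace_add_chainTop _ _ hα] at this⟩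
  have hp : 1 ≤ chainTopCoeff α β := by
    have := (rootSpace_zsmul_add_ne_bot_iff (α := α) (β := β) hα 1).1 (by simpa using hαβ)
    exact_mod_cast this.1
  have hpl : chainTopCoeff α β ≤ chainLength α β := chainTopCoeff_le_chainLength α β
  obtain ⟨n, hn⟩ : ∃ n, chainTopCoeff α β = n + 1 := ⟨chainTopCoeff α β - 1, by omega⟩
  -- The space 𝔤_β is spanned by fⁿ⁺¹t with t at the top of the α-string, and e sends this vector to
  -- a nonzero multiple of fⁿt.
  have hmem := toEnd_pow_apply_mem hf ht (chainTopCoeff α β)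
  have hwt : (chainTopCoeff α β • (-α : H → ℂ) + chainTop α β : H → ℂ) = β := by
    rw [coe_chainTop']
    simp
  rw [hwt] at hmem
  have hne := prim.pow_toEnd_f_ne_zero_of_eq_nat rfl hpl
  have hne' := prim.pow_toEnd_f_ne_zero_of_eq_nat rfl (i := n) (by omega)
  have hlie := prim.lie_e_pow_succ_toEnd_f n
  obtain ⟨c, rfl⟩ : ∃ c : ℂ, c • e = x := by
    simpa using (finrank_eq_one_iff_of_nonzero' ⟨e, he⟩ (by simpa using isSl2.e_ne_zero)).mp
      (finrank_rootSpace_eq_one _ hα) ⟨x, hx⟩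
  obtain ⟨c', rfl⟩ : ∃ c : ℂ, c • ((toEnd ℂ L L f ^ chainTopCoeff α β) t) = y := by
    simpa using (finrank_eq_one_iff_of_nonzero' ⟨_, hmem⟩ (by simpa using hne)).mp
      (finrank_rootSpace_eq_one _ hβ) ⟨y, hy⟩
  rw [smul_lie, lie_smul, hn, hlie]
  refine smul_ne_zero (left_ne_zero_of_smul hx0) (smul_ne_zero (left_ne_zero_of_smul hy0)
    (smul_ne_zero (mul_ne_zero (by exact_mod_cast n.succ_ne_zero) ?_) hne'))
  rw [sub_ne_zero]
  exact_mod_cast (by omega : chainLength α β ≠ n)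

theorem mem_rootsIn_adEigenspace (Z : H) (k : ℤ) (α : H.root) :
    α ∈ rootsIn (adEigenspace Z k) ↔ (rootSystem H).root α Z = (k : ℂ) := by
  have key : ∀ x ∈ rootSpace H α.1, ⁅(Z : L), x⁆ = (rootSystem H).root α Z • x := fun x hx ↦
    lie_eq_smul_of_mem_rootSpace hx Z
  constructor
  · intro h
    obtain ⟨x, hx, hx0⟩ := α.1.exists_ne_zero
    have h1 : ⁅(Z : L), x⁆ = (k : ℂ) • x := Module.End.mem_eigenspace_iff.1 (h hx)
    rw [key x hx] at h1
    exact smul_left_injective _ hx0 h1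
  · intro h x hx
    refine Module.End.mem_eigenspace_iff.2 ?_
    rw [LieAlgebra.ad_apply, key x hx, h]

theorem root_gradingElt (b : (rootSystem H).Base) (j : b.support) (α : H.root) :
    (rootSystem H).root α (gradingElt b j) = (coeff b j α : ℂ) := by
  rw [← coord_root b j α]
  have := (evalEquiv ℂ H).apply_symm_apply (b.toWeightBasis.coord j)
  exact DFunLike.congr_fun this ((rootSystem H).root α)

theorem rootsIn_grade (b : (rootSystem H).Base) (i : b.support) (k : ℤ) :
    rootsIn (grade b i k) = {α | coeff b i α = k} := by
  ext α
  rw [grade, mem_rootsIn_adEigenspace, root_gradingElt]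
  exact Int.cast_inj

/-- The operator T = ad Z_i satisfies T³ = T, so its integer eigenvalues are at most 1. -/
theorem coeff_le_one {b : (rootSystem H).Base} {i : b.support} (hi : IsCominuscule b i)
    (α : H.root) : coeff b i α ≤ 1 := by
  have key : ∀ k : ℤ, ∀ x ∈ grade b i k, ⁅(gradingElt b i : L), x⁆ = (k : ℂ) • x := fun k x hx ↦
    Module.End.mem_eigenspace_iff.1 hx
  set T := LieAlgebra.ad ℂ L (gradingElt b i : L)
  have hcube : ∀ x : L, T (T (T x)) = T x := by
    intro x
    have hx : x ∈ grade b i 1 ⊔ grade b i 0 ⊔ grade b i (-1) := by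
      rw [show _ = _ from hi]
      trivial
    obtain ⟨y', hy', z, hz, rfl⟩ := Submodule.mem_sup.1 hx
    obtain ⟨y, hy, u, hu, rfl⟩ := Submodule.mem_sup.1 hy'
    have h1 : T y = y := (key 1 y hy).trans (by simp)
    have h2 : T u = 0 := (key 0 u hu).trans (by simp)
    have h3 : T z = -z := (key (-1) z hz).trans (by simp)
    simp [h1, h2, h3]
  obtain ⟨x, hx, hx0⟩ := α.1.exists_ne_zero
  have hTx : T x = (coeff b i α : ℂ) • x := by
    rw [← root_gradingElt]
    exact lie_eq_smul_of_mem_rootSpace hx _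
  have h1 := hcube x
  simp only [hTx, map_smul, smul_smul] at h1
  have h2 := smul_left_injective _ hx0 h1
  have h3 : coeff b i α * (coeff b i α * coeff b i α) = coeff b i α := by
    have h2' : ((coeff b i α * (coeff b i α * coeff b i α) : ℤ) : ℂ) = (coeff b i α : ℤ) := by
      push_cast
      linear_combination h2
    exact_mod_cast h2'
  by_contra! h
  nlinarith

theorem inversions_eq_invSet (b : (rootSystem H).Base) (w : Weyl H) :
    inversions b w = invSet b w := by
  ext α
  constructor
  · rintro ⟨⟨β, hβ, rfl⟩, hα⟩
    exact ⟨hα, by dsimp only; rw [inv_smul_smul]; exact hβ⟩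
  · rintro ⟨hα, h⟩
    exact ⟨⟨w⁻¹ • α, h, smul_inv_smul w α⟩, hα⟩

theorem length_eq_ncard_invSet (b : (rootSystem H).Base) (w : Weyl H) :
    length b w = (invSet b w).ncard :=
  sInf_length_eq_ncard_invSet w

theorem mem_hasse_iff {b : (rootSystem H).Base} {i : b.support} (hi : IsCominuscule b i)
    (w : Weyl H) : w ∈ hasse b i ↔ ∀ α ∈ invSet b w, coeff b i α = 1 := by
  classical
  constructor
  · intro h
    refine coeff_eq_one_of_mem_invSet i.2 (coeff_le_one hi) fun j hj hji ↦ ?_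
    rw [← length_eq_ncard_invSet, ← length_eq_ncard_invSet]
    refine h _ (Subgroup.subset_closure ⟨j, ?_, rfl⟩)
    rw [rootsIn_grade]
    change coeff b i j = 0
    rw [coeff_simple b i.2 hj, if_neg (Ne.symm hji)]
  · intro h u hu
    rw [length_eq_ncard_invSet, length_eq_ncard_invSet]
    rw [leviWeyl, rootsIn_grade] at hu
    exact ncard_invSet_le_mul h (coeff_smul_of_mem_closure i.2 hu)

theorem disjoint_nilp {b : (rootSystem H).Base} {w : Weyl H} {β : H.root} (hβ : β ∉ invSet b w) :
    Disjoint (nilp b w) (rootSpace H (-(β.1 : H → ℂ)) : Submodule ℂ L) := by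
  have h := (LieSubmodule.iSupIndep_toSubmodule.2 (iSupIndep_genWeightSpace ℂ H L))
    (-(β.1 : H → ℂ))
  refine (h.mono_right ?_).symm
  rw [nilp, inversions_eq_invSet]
  refine iSup₂_le fun α hα ↦ ?_
  refine le_iSup₂_of_le (-(α.1 : H → ℂ)) ?_ le_rfl
  intro h
  have : α = β := Subtype.ext (Weight.ext fun z ↦ congrFun (neg_injective h) z)
  exact hβ (this ▸ hα)

/-- Since [𝔤_{-α_j}, 𝔤_{-α}] is nonzero whenever α + α_j is a root, stability of 𝔫_w can be tested
root by root. -/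
theorem mem_marking_iff {b : (rootSystem H).Base} {i : b.support} {w : Weyl H}
    (j : b.support) :
    j ∈ marking b i w ↔ (j : H.root) ∈ markSet b i w := by
  classical
  have hji : j ≠ i ↔ (j : H.root) ≠ i := by rw [Ne, Subtype.ext_iff]
  have hroot : ∀ {α β γ : H.root}, (rootSystem H).root γ =
      (rootSystem H).root α + (rootSystem H).root β →
      (γ.1 : H → ℂ) = (α.1 : H → ℂ) + (β.1 : H → ℂ) := fun h ↦
    funext fun z ↦ LinearMap.congr_fun h z
  constructor
  · rintro ⟨hne, hsub⟩
    rw [hji] at hne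
    refine ⟨j.2, hne, ?_⟩
    obtain ⟨x, hx, hxs⟩ := Set.not_subset.1 hsub
    have hx0 : x ∈ grade b i 0 := by
      obtain ⟨k, hk⟩ := exists_root_neg (rootSystem H) (j : H.root)
      have hk0 : k ∈ rootsIn (grade b i 0) := by
        rw [rootsIn_grade]
        change coeff b i k = 0
        rw [(coeff_isLinear b i.2).neg_eq hk, coeff_simple b i.2 j.2, if_neg (Ne.symm hne), neg_zero]
      have : (k.1 : H → ℂ) = -(j.1.1 : H → ℂ) := funext fun z ↦ LinearMap.congr_fun hk z
      exact hk0 (by rw [this]; exact hx)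
    obtain ⟨y, hy, hxy⟩ : ∃ y ∈ nilp b w, ⁅x, y⁆ ∉ nilp b w := by
      by_contra! h
      exact hxs ⟨hx0, h⟩
    obtain ⟨α, hα, y, hy, hxy⟩ : ∃ α ∈ invSet b w, ∃ y ∈ rootSpace H (-(α.1 : H → ℂ)),
        ⁅x, y⁆ ∉ nilp b w := by
      by_contra! h
      have hle : nilp b w ≤ (nilp b w).comap (LieAlgebra.ad ℂ L x : L →ₗ[ℂ] L) := by
        conv_lhs => rw [nilp, inversions_eq_invSet]
        exact iSup₂_le fun α hα y hy ↦ h α hα y hy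
      exact hxy (hle hy)
    have hmem : ⁅x, y⁆ ∈ rootSpace H (-(j.1.1 : H → ℂ) + -(α.1 : H → ℂ)) :=
      lie_mem_genWeightSpace_of_mem_genWeightSpace hx hy
    have hne0 : ⁅x, y⁆ ≠ 0 := fun h ↦ hxy (by rw [h]; exact zero_mem _)
    let γ : Weight ℂ H L := ⟨-(j.1.1 : H → ℂ) + -(α.1 : H → ℂ), fun h ↦ hne0 (by
      rw [← LieSubmodule.mem_bot (R := ℂ) (L := H), ← h]
      exact hmem)⟩
    have hγ0 : γ.IsNonZero := by
      intro h
      refine root_add_root_ne_zero hα.1 (RootPairing.Base.isPos_of_mem_support j.2) ?_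
      ext z
      have := congrFun (show (γ : H → ℂ) = 0 from h) z
      change α.1 z + j.1.1 z = 0
      have h' : -(j.1.1 z) + -(α.1 z) = 0 := this
      linear_combination -h'
    obtain ⟨β, hβ⟩ := exists_root_neg (rootSystem H)
      (⟨γ, by simpa using hγ0⟩ : H.root)
    have hβ' : (β.1 : H → ℂ) = (α.1 : H → ℂ) + (j.1.1 : H → ℂ) := by
      funext z
      have h1 : β.1 z = -(-(j.1.1 z) + -(α.1 z)) := LinearMap.congr_fun hβ z
      rw [h1]
      simp [add_comm]
    refine ⟨α, hα, β, fun hβm ↦ hxy ?_, ?_⟩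
    · have : (rootSpace H (-(β.1 : H → ℂ)) : Submodule ℂ L) ≤ nilp b w := by
        rw [nilp, inversions_eq_invSet]
        exact le_iSup₂_of_le β hβm le_rfl
      refine this ?_
      rw [hβ', neg_add_rev]
      exact hmem
    · ext z
      exact congrFun hβ' z
  · rintro ⟨-, hne, α, hα, β, hβ, hαβ⟩
    refine ⟨hji.2 hne, fun hsub ↦ ?_⟩
    obtain ⟨x, hx, hx0⟩ := (-j.1.1 : Weight ℂ H L).exists_ne_zero
    obtain ⟨y, hy, hy0⟩ := (-α.1 : Weight ℂ H L).exists_ne_zero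
    have hyn : y ∈ nilp b w := by
      have : (rootSpace H (-(α.1 : H → ℂ)) : Submodule ℂ L) ≤ nilp b w := by
        rw [nilp, inversions_eq_invSet]
        exact le_iSup₂_of_le α hα le_rfl
      exact this hy
    have hsum : ((-j.1.1 : Weight ℂ H L) + (-α.1 : Weight ℂ H L) : H → ℂ) = -(β.1 : H → ℂ) := by
      rw [hroot hαβ]
      simp
    have hxy : ⁅x, y⁆ ∈ rootSpace H (-(β.1 : H → ℂ)) := by
      rw [← hsum]
      exact lie_mem_genWeightSpace_of_mem_genWeightSpace hx hy
    have h0 : ⁅x, y⁆ ≠ 0 := by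
      refine lie_ne_zero_of_add_ne_bot ?_ ?_ ?_ hx hy hx0 hy0
      · exact Weight.IsNonZero.neg (H.isNonZero_coe_root _)
      · exact Weight.IsNonZero.neg (H.isNonZero_coe_root _)
      · rw [hsum]
        exact (-β.1 : Weight ℂ H L).genWeightSpace_ne_bot
    exact h0 (Submodule.disjoint_def.1 (disjoint_nilp hβ) _ ((hsub hx).2 y hyn) hxy)

theorem root_markingElt {b : (rootSystem H).Base} {i : b.support} {w : Weyl H}
    (α : H.root) :
    (rootSystem H).root α (markingElt b i w) = (markDegree b i w α : ℂ) := by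
  classical
  rw [markingElt, map_sum, markDegree, Finset.sum_filter, Int.cast_sum,
    ← Finset.sum_coe_sort b.support]
  refine Finset.sum_congr rfl fun j _ ↦ ?_
  simp only [mem_marking_iff j]
  split_ifs
  · exact root_gradingElt b j α
  · simp

theorem mem_rootsIn_bigrade {b : (rootSystem H).Base} {i : b.support} {w : Weyl H}
    (k l : ℤ) (α : H.root) :
    α ∈ rootsIn (bigrade b i w k l) ↔ coeff b i α = k ∧ markDegree b i w α = l := by
  have h1 : α ∈ rootsIn (bigrade b i w k l) ↔
      α ∈ rootsIn (grade b i k) ∧ α ∈ rootsIn (adEigenspace (markingElt b i w) l) := by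
    simp only [rootsIn, bigrade, Set.mem_ofPred_eq, le_inf_iff]
  rw [h1, rootsIn_grade, mem_rootsIn_adEigenspace, root_markingElt, Int.cast_inj]
  rfl

/-- Finiteness and nonemptiness make the integer `sSup` a true maximum rather than a default value.
-/
theorem isGreatest_level {b : (rootSystem H).Base} {i : b.support} {w : Weyl H}
    (hne : (invSet b w).Nonempty) :
    IsGreatest (markDegree b i w '' invSet b w) (level b i w) := by
  have h : level b i w = sSup (markDegree b i w '' invSet b w) := by
    rw [level, inversions_eq_invSet]
    congr 1
    ext l
    simp only [root_markingElt, Int.cast_inj]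
    rfl
  rw [h]
  have hfin : (markDegree b i w '' invSet b w).Finite := (Set.toFinite _).image _
  exact ⟨(hne.image _).csSup_mem hfin, fun x hx ↦ le_csSup hfin.bddAbove hx⟩

theorem highest_eq_topSet {b : (rootSystem H).Base} {i : b.support} {w : Weyl H}
    :
    highest b i w = topSet b i w (level b i w) := by
  ext ε
  constructor
  · rintro ⟨h1, h2⟩
    rw [mem_rootsIn_bigrade] at h1
    exact ⟨h1.1, h1.2, fun α hα h0 h0' ↦ h2 α ⟨hα, (mem_rootsIn_bigrade _ _ _).2 ⟨h0, h0'⟩⟩⟩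
  · rintro ⟨h1, h2, h3⟩
    refine ⟨(mem_rootsIn_bigrade _ _ _).2 ⟨h1, h2⟩, fun α ⟨hα, hα'⟩ ↦ ?_⟩
    rw [mem_rootsIn_bigrade] at hα'
    exact h3 α hα hα'.1 hα'.2

theorem removed_eq_removedSet {b : (rootSystem H).Base} {i : b.support} {w : Weyl H}
    (ε : H.root) :
    removed b i w ε = removedSet b i w (level b i w) ε := by
  rw [removed, removedSet]
  congr 1
  ext ν
  simp only [Set.mem_ofPred_eq, mem_rootsIn_bigrade, and_assoc]

end Lie

end

end Cominuscule

/-! ### The main theorem -/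

open Cominuscule LieAlgebra.IsKilling in
theorem mainTheorem4 {L : Type*} [LieRing L] [LieAlgebra ℂ L] [FiniteDimensional ℂ L]
    [LieAlgebra.IsSimple ℂ L] (H : LieSubalgebra ℂ L) [H.IsCartanSubalgebra]
    (b : (LieAlgebra.IsKilling.rootSystem H).Base) (i : b.support)
    (hi : Cominuscule.IsCominuscule b i)
    (w : Cominuscule.Weyl H) (hw : w ∈ Cominuscule.hasse b i) (hw₁ : w ≠ 1)
    (hw₀ : ¬ Cominuscule.IsLongest b i w) :
    Cominuscule.inversions b w =
        {α | α ∈ Cominuscule.rootsIn (Cominuscule.grade b i 1) ∧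
          ∃ l : ℤ, l ≤ Cominuscule.level b i w ∧
            (LieAlgebra.IsKilling.rootSystem H).root α (Cominuscule.markingElt b i w) = (l : ℂ)} ∧
      (∀ ε ∈ Cominuscule.highest b i w, ∃ v, Cominuscule.IsWEps b i w ε v) ∧
      {Φ : Set H.root | ∃ ε ∈ Cominuscule.highest b i w, ∃ v,
          Cominuscule.IsWEps b i w ε v ∧ Cominuscule.inversions b v = Φ} =
        {Φ : Set H.root | Maximal (Cominuscule.IsAdmissible b i w) Φ} := by
  have hc := coeff_le_one hi
  rw [mem_hasse_iff hi] at hw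
  have hne : (invSet b w).Nonempty := by
    rw [Set.nonempty_iff_ne_empty]
    exact fun h ↦ hw₁ (eq_one_of_invSet_eq_empty h)
  have ha := isGreatest_level (i := i) hne
  have hex : ∀ ε ∈ highest b i w, ∃ v, IsWEps b i w ε v := by
    intro ε hε
    rw [highest_eq_topSet] at hε
    obtain ⟨v, hv⟩ := exists_invSet_eq_sdiff i.2 hc hw ha hε
    refine ⟨v, (mem_hasse_iff hi v).2 fun α hα ↦ hw α ?_, ?_⟩
    · rw [hv] at hα
      exact hα.1
    · rw [inversions_eq_invSet, inversions_eq_invSet, removed_eq_removedSet, hv]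
  have hmemε : ∀ ε ∈ highest b i w, ε ∈ inversions b w ∧
      ε ∉ rootsIn (bigrade b i w 1 (level b i w)) := by
    intro ε hε
    rw [highest_eq_topSet] at hε
    obtain ⟨h1, h2, -⟩ := hε
    rw [inversions_eq_invSet, mem_invSet_iff_markDegree_le i.2 hc hw ha h1,
      mem_rootsIn_bigrade]
    constructor <;> omega
  have hadm : ∀ ε ∈ highest b i w, IsAdmissible b i w (inversions b w \ removed b i w ε) := by
    intro ε hε
    obtain ⟨v, hv, hv'⟩ := hex ε hε
    obtain ⟨h1, h2⟩ := hmemε ε hε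
    exact ⟨⟨v, hv, hv'⟩, Set.sdiff_subset, fun h ↦ h2 (h ⟨h1, fun h' ↦ h'.2 (.inl rfl)⟩)⟩
  have hsub : ∀ Φ ε, IsAdmissible b i w Φ → ε ∉ Φ → Φ ⊆ inversions b w \ removed b i w ε := by
    rintro Φ ε ⟨⟨v, hv, rfl⟩, hle, -⟩ hε
    rw [mem_hasse_iff hi] at hv
    refine Set.subset_sdiff.2 ⟨hle, ?_⟩
    rw [inversions_eq_invSet] at hε ⊢
    rw [removed_eq_removedSet]
    exact disjoint_removedSet i.2 hv hε
  refine ⟨?_, hex, ?_⟩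
  · ext α
    rw [inversions_eq_invSet, rootsIn_grade]
    constructor
    · intro hα
      refine ⟨hw α hα, markDegree b i w α, ha.2 (Set.mem_image_of_mem _ hα), ?_⟩
      exact root_markingElt α
    · rintro ⟨h1, l, hl, h2⟩
      rw [root_markingElt, Int.cast_inj] at h2
      rw [mem_invSet_iff_markDegree_le i.2 hc hw ha h1, h2]
      exact hl
  · ext Φ
    constructor
    · rintro ⟨ε, hε, v, ⟨-, hv⟩, rfl⟩
      rw [hv]
      refine ⟨hadm ε hε, fun Ψ hΨ hle ↦ ?_⟩
      -- If the larger set Ψ contained ε, its complement in Δ(w) would lie in Δ(w, ε) \ {ε} ⊂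
      -- Δ(𝔤_{1,a}), so Ψ would not be admissible.
      refine hsub Ψ ε hΨ fun hεΨ ↦ hΨ.2.2 ?_
      rintro x ⟨hx, hxΨ⟩
      have hxr : x ∈ removed b i w ε := by
        by_contra hxr
        exact hxΨ (hle ⟨hx, hxr⟩)
      rcases hxr with rfl | hxr
      · exact absurd hεΨ hxΨ
      · exact hxr.1
    · intro hΦ
      obtain ⟨⟨v, hv, rfl⟩, hle, hnot⟩ := hΦ.1
      obtain ⟨x, ⟨hx, hxv⟩, hxa⟩ := Set.not_subset.1 hnot
      have hv' := (mem_hasse_iff hi v).1 hv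
      rw [inversions_eq_invSet] at hx hxv
      rw [mem_rootsIn_bigrade] at hxa
      obtain ⟨ε, hε, hεv⟩ := exists_mem_topSet i.2 hc hw ha hv' hx hxv
        fun h ↦ hxa ⟨hw x hx, h⟩
      rw [← highest_eq_topSet] at hε
      rw [← inversions_eq_invSet] at hεv
      obtain ⟨u, hu⟩ := hex ε hε
      refine ⟨ε, hε, u, hu, ?_⟩
      rw [hu.2]
      exact (hΦ.eq_of_subset (hadm ε hε) (hsub _ ε hΦ.1 hεv)).symm
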